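/- **Setting.** For each $n$ let $(\mathcal I_n,\mathbf d)$ be a metric space with $n$ points and distance $\mathbf d:\mathcal I_n\times\mathcal I_n\to[0,\infty]$ such that $\mathbf d(i,j)\ge 1$ for all $i\ne j$, and let $X_i$, $i\in\mathcal I_n$, be random vectors in $\mathbb R^d$ on a probability space (both may depend on $n$). For $\sigma$-algebras $\mathcal F_1,\mathcal F_2$ let $$\beta(\mathcal F_1,\mathcal F_2)=\sup\tfrac12\sum_{i,j}|P(A_i\cap B_j)-P(A_i)P(B_j)|,$$ the supremum being over all finite partitions $(A_i)\subset\mathcal F_1$ and $(B_j)\subset\mathcal F_2$ of the probability space. For $n_1,n_2\in\mathbb N\cup\{\infty\}$ let $\beta_n(n_1,n_2,m)$ be the supremum of $\beta\big(\sigma(X_i:i\in\mathcal I'),\sigma(X_i:i\in\mathcal I'')\big)$ over all $\mathcal I',\mathcal I''\subset\mathcal I_n$ with $|\mathcal I'|\le n_1$, $|\mathcal I''|\le n_2$ and $\mathbf d(i,j)\ge m$ for all $i\in\mathcal I'$, $j\in\mathcal I''$, and let $\beta(n_1,n_2,m)=\sup_n\beta_n(n_1,n_2,m)$. Let $\eta_m=\max_{i\in\mathcal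 I_n}|\{j\in\mathcal I_n:\mathbf d(i,j)\le m\}|$. Let $H=H_n:\mathbb R^d\times\mathbb R^d\to\mathbb R$ be measurable and symmetric kernels with $\mathbb E H_n^2(X_i,\tilde X_j)<\infty$ for all $n$ and all $i\ne j$ in $\mathcal I_n$, where $\tilde X_j$ is a copy of $X_j$ independent of $X_i$, and let $$\mathbf H_3=\sup_n\sup_{i\neq j\in\mathcal I_n}\max\{\|H_n(X_i,X_j)\|_{3},\|H_n(X_i,\tilde X_j)\|_{3}\}.$$ Put $S_n=\sum_{i\ne k}H_n(X_i,X_k)$, $\hat H_k(x)=\mathbb E H_n(X_k,x)$, $\theta_{ik}=\mathbb E\hat H_k(X_i)$, $h_i=(n-1)^{-1}\sum_{k\ne i}(\hat H_k(X_i)-\theta_{ik})$, $\nu_n^2=\operatorname{Var}\big(\sum_i h_i\big)$ and $$W_n=\frac{1}{2(n-1)\nu_n}\Big(S_n-\sum_{i\ne k}\theta_{ik}\Big).$$ **Theorem.** Suppose that $\nu_n^2=\Theta(n)$ and $\mathbf H_3<\infty$, and that for some sequence $m=m(n)\ge 1$ we have, as $n\to\infty$, $$\eta_{m}^4=o(n)\qquad\text{and}\qquad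 n\,\beta(1,3,m)^{1/3}+\sqrt{n\,\beta(2,\infty,m)}=o(1).$$ Then $W_n$ converges in distribution to $N(0,1)$ as $n\to\infty$. -/

import Mathlib

open MeasureTheory ProbabilityTheory Filter Topology Asymptotics
open scoped ENNReal NNReal

noncomputable section

/-- `A` is a finite partition of `Ω` into `F`-measurable cells (empty cells are allowed; they
contribute nothing to the `β`-mixing sum). -/
structure IsFinitePartition {Ω : Type*} (F : MeasurableSpace Ω) {a : ℕ} (A : Fin a → Set Ω) :
    Prop where
  measurable : ∀ i, MeasurableSet[F] (A i)
  disjoint : Pairwise fun i j => Disjoint (A i) (A j)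
  cover : ⋃ i, A i = Set.univ

/-- The `β`-mixing (absolute regularity) coefficient of two sub-`σ`-algebras: the supremum over
pairs of finite measurable partitions of `(1/2) ∑ |P(A ∩ B) - P(A) P(B)|`. -/
def betaCoeff {Ω : Type*} {mΩ : MeasurableSpace Ω} (μ : Measure Ω) (F₁ F₂ : MeasurableSpace Ω) :
    ℝ≥0∞ :=
  ⨆ (a : ℕ) (b : ℕ) (A : Fin a → Set Ω) (B : Fin b → Set Ω)
    (_ : IsFinitePartition F₁ A) (_ : IsFinitePartition F₂ B),
    ENNReal.ofReal ((1 / 2) * ∑ i, ∑ j, |μ.real (A i ∩ B j) - μ.real (A i) * μ.real (B j)|)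

/-- The `σ`-algebra generated by the variables `X i`, `i ∈ J`. -/
abbrev sigmaGen {ι Ω E : Type*} [MeasurableSpace E] (X : ι → Ω → E) (J : Finset ι) :
    MeasurableSpace Ω :=
  ⨆ i ∈ J, MeasurableSpace.comap (X i) inferInstance

/-- The distance between two groups of nodes (equal to `∞` when one of them is empty). -/
def groupDist {ι : Type*} [EMetricSpace ι] (J₁ J₂ : Finset ι) : ℝ≥0∞ :=
  ⨅ i ∈ J₁, ⨅ j ∈ J₂, edist i j

/-- The ordered pairs of groups of sizes at most `n₁` and `n₂` (possibly `⊤`) which are at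
distance at least `m`. -/
def separatedPairs (ι : Type*) [EMetricSpace ι] (n₁ n₂ : ℕ∞) (m : ℝ≥0) :
    Set (Finset ι × Finset ι) :=
  {J | (J.1.card : ℕ∞) ≤ n₁ ∧ (J.2.card : ℕ∞) ≤ n₂ ∧ (m : ℝ≥0∞) ≤ groupDist J.1 J.2}

/-- The mixing coefficient `βₙ(n₁, n₂, m)` of one sample. -/
def sampleBeta {ι Ω E : Type*} [EMetricSpace ι] [MeasurableSpace Ω] [MeasurableSpace E]
    (μ : Measure Ω) (X : ι → Ω → E) (n₁ n₂ : ℕ∞) (m : ℝ≥0) : ℝ≥0∞ :=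
  ⨆ J ∈ separatedPairs ι n₁ n₂ m, betaCoeff μ (sigmaGen X J.1) (sigmaGen X J.2)

/-- `β(n₁, n₂, m) = supₙ βₙ(n₁, n₂, m)` for a sequence of samples. -/
def arrayBeta {I Ω : ℕ → Type*} {E : Type*} [∀ n, EMetricSpace (I n)]
    [∀ n, MeasurableSpace (Ω n)] [MeasurableSpace E] (μ : ∀ n, Measure (Ω n))
    (X : ∀ n, I n → Ω n → E) (n₁ n₂ : ℕ∞) (m : ℝ≥0) : ℝ≥0∞ :=
  ⨆ n, sampleBeta (μ n) (X n) n₁ n₂ m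

open scoped Classical in
/-- The `m`-neighbourhood `{j : d(i, j) ≤ m}` of a node. -/
def nbhd {ι : Type*} [Fintype ι] [EMetricSpace ι] (m : ℝ≥0) (i : ι) : Finset ι :=
  Finset.univ.filter fun j => edist i j ≤ (m : ℝ≥0∞)

/-- `η_m`, the largest cardinality of an `m`-neighbourhood. -/
def maxNbhd (ι : Type*) [Fintype ι] [EMetricSpace ι] (m : ℝ≥0) : ℕ :=
  Finset.univ.sup fun i : ι => (nbhd m i).card

/-- `sup_{i ≠ j} max (‖H(X_i, X_j)‖_p, ‖H(X_i, X̃_j)‖_p)` for one sample, where `X̃_j` is a copy of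
`X_j` independent of `X_i`, so that `(X_i, X̃_j)` has the product of the marginal laws. -/
def sampleKernelNorm {ι Ω E : Type*} [MeasurableSpace Ω] [MeasurableSpace E]
    (μ : Measure Ω) (X : ι → Ω → E) (H : E → E → ℝ) (p : ℝ≥0∞) : ℝ≥0∞ :=
  ⨆ (i : ι) (j : ι) (_ : i ≠ j),
    max (eLpNorm (fun ω => H (X i ω) (X j ω)) p μ)
      (eLpNorm (Function.uncurry H) p ((μ.map (X i)).prod (μ.map (X j))))

/-- `𝐇_p`, the supremum over all sample sizes of the kernel norms. -/
def arrayKernelNorm {I Ω : ℕ → Type*} {E : Type*} [∀ n, MeasurableSpace (Ω n)]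
    [MeasurableSpace E] (μ : ∀ n, Measure (Ω n)) (X : ∀ n, I n → Ω n → E)
    (H : ℕ → E → E → ℝ) (p : ℝ≥0∞) : ℝ≥0∞ :=
  ⨆ n, sampleKernelNorm (μ n) (X n) (H n) p

section UStatistic

/-- `Ĥ_k(x) = 𝔼 H(X_k, x)`. -/
def kernelProj {ι Ω E : Type*} [MeasurableSpace Ω] (μ : Measure Ω) (X : ι → Ω → E)
    (H : E → E → ℝ) (k : ι) (x : E) : ℝ :=
  ∫ ω, H (X k ω) x ∂μ

/-- `θ_{ik} = 𝔼 Ĥ_k(X_i)`. -/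
def kernelMean {ι Ω E : Type*} [MeasurableSpace Ω] (μ : Measure Ω) (X : ι → Ω → E)
    (H : E → E → ℝ) (i k : ι) : ℝ :=
  ∫ ω, kernelProj μ X H k (X i ω) ∂μ

open scoped Classical in
/-- The U-statistic `S = ∑_{i ≠ k} H(X_i, X_k)`. -/
def uStat {ι Ω E : Type*} [Fintype ι] (X : ι → Ω → E) (H : E → E → ℝ) (ω : Ω) : ℝ :=
  ∑ i, ∑ k ∈ Finset.univ.erase i, H (X i ω) (X k ω)

open scoped Classical in
/-- `h_i = (n - 1)⁻¹ ∑_{k ≠ i} (Ĥ_k(X_i) - θ_{ik})`, where `n` is the sample size. -/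
def linProj {ι Ω E : Type*} [Fintype ι] [MeasurableSpace Ω] (μ : Measure Ω) (X : ι → Ω → E)
    (H : E → E → ℝ) (i : ι) (ω : Ω) : ℝ :=
  ((Fintype.card ι : ℝ) - 1)⁻¹ *
    ∑ k ∈ Finset.univ.erase i, (kernelProj μ X H k (X i ω) - kernelMean μ X H i k)

/-- `ν² = Var (∑ i, h_i)`. -/
def projVar {ι Ω E : Type*} [Fintype ι] [MeasurableSpace Ω] (μ : Measure Ω) (X : ι → Ω → E)
    (H : E → E → ℝ) : ℝ :=
  variance (fun ω => ∑ i, linProj μ X H i ω) μ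

open scoped Classical in
/-- The normalised U-statistic `W = (S - ∑_{i ≠ k} θ_{ik}) / (2 (n - 1) ν)`. -/
def normUStat {ι Ω E : Type*} [Fintype ι] [MeasurableSpace Ω] (μ : Measure Ω) (X : ι → Ω → E)
    (H : E → E → ℝ) (ω : Ω) : ℝ :=
  (uStat X H ω - ∑ i, ∑ k ∈ Finset.univ.erase i, kernelMean μ X H i k) /
    (2 * ((Fintype.card ι : ℝ) - 1) * Real.sqrt (projVar μ X H))

end UStatistic

end

/-! ### Total variation control of integrals -/

/-! The Hoeffding decomposition (`uStat_sub_eq`) writes the centred U-statistic as `2 (n - 1) ∑ h_i`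
plus a sum of completely degenerate kernels. After division by `2 (n - 1) ν` the first part is `∑
ξ_i`, where `ξ_i = h_i / ν` is centred, depends on `X_i` only, and has `L³` norm of order
`n^(-1/2)`; the sum has variance one. It is shown to be asymptotically normal, and the second part
to vanish in `L²`.

The tool for dependence is a decoupling inequality (`norm_integral_sub_integral_prod_le`): half the
`β`-coefficient's defining sum controls the total variation distance between the joint law of two
groups of variables and the product of their laws, up to a factor two, and Hölder's inequality then
compares the integrals of any function with a `p`-th moment at a cost `β^(1 - 1/p)`.

For the degenerate part, the second moment is a sum over quadruples of nodes. If one of the first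
three nodes is far from the other three, decoupling it makes the expectation nearly zero, because a
degenerate kernel integrates to zero in each variable (`abs_integral_degKernel_mul_le`). At most `9
(n η)²` quadruples have no such isolated node (`sum_quadruple_le`). Thus the second moment is of
order `n⁴ β(1,3,m)^(1/3) + n² η²`, against a squared normalisation of order at least `n³`.

For the linear part `W`, with characteristic function `φ`, Stein's method is applied to the
exponentials: `𝔼 W e^{itW}` is close to `i t φ(t)` (`norm_integral_sum_mul_cexp_sub_le`). This comes
from removing the neighbourhood of each node from the exponent, expanding to second order, and
decorrelating the resulting products `ξ_i ξ_j` from the exponential. Since `φ'(t) = i 𝔼 W e^{itW}`,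
the function `φ` nearly solves `φ' = -t φ`, so it is close to `e^{-t²/2}`
(`norm_integral_cexp_sub_le`). Lévy's continuity theorem concludes. -/

theorem enorm_integral_sub_integral_le {α F : Type*} [MeasurableSpace α] [NormedAddCommGroup F]
    [NormedSpace ℝ F] {P Q : Measure α} [IsFiniteMeasure P] [IsFiniteMeasure Q] {δ : ℝ}
    (hδ : ∀ s, MeasurableSet s → |P.real s - Q.real s| ≤ δ) {p : ℝ≥0∞} (hp : 1 ≤ p) {f : α → F}
    (hfP : MemLp f p P) (hfQ : MemLp f p Q) :
    ‖∫ x, f x ∂P - ∫ x, f x ∂Q‖ₑ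
      ≤ (eLpNorm f p P + eLpNorm f p Q) * ENNReal.ofReal δ ^ (1 - 1 / p.toReal) := by
  -- On a Hahn set `D` one has `Q ≤ P`, and `P ≤ Q` off it. Removing the common part `Q|_D +
  -- P|_{Dᶜ}` leaves two positive measures `κ₁ ≤ P` and `κ₂ ≤ Q` of mass at most `δ`, on which
  -- Hölder's inequality produces the power of `δ`.
  obtain ⟨D, hD, h1, h2⟩ := hahn_decomposition P Q
  have hle1 : Q.restrict D ≤ P.restrict D := Measure.le_iff.2 fun s hs => by
    rw [Measure.restrict_apply hs, Measure.restrict_apply hs]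
    exact h1 _ (hs.inter hD) Set.inter_subset_right
  have hle2 : P.restrict Dᶜ ≤ Q.restrict Dᶜ := Measure.le_iff.2 fun s hs => by
    rw [Measure.restrict_apply hs, Measure.restrict_apply hs]
    exact h2 _ (hs.inter hD.compl) Set.inter_subset_right
  set κ₁ := P.restrict D - Q.restrict D with hκ₁
  set κ₂ := Q.restrict Dᶜ - P.restrict Dᶜ with hκ₂
  have e1 : κ₁ + Q.restrict D = P.restrict D := Measure.sub_add_cancel_of_le hle1
  have e2 : κ₂ + P.restrict Dᶜ = Q.restrict Dᶜ := Measure.sub_add_cancel_of_le hle2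
  have eP : Q.restrict D + P.restrict Dᶜ + κ₁ = P := by
    conv_rhs => rw [← Measure.restrict_add_restrict_compl (μ := P) hD, ← e1]
    abel
  have eQ : Q.restrict D + P.restrict Dᶜ + κ₂ = Q := by
    conv_rhs => rw [← Measure.restrict_add_restrict_compl (μ := Q) hD, ← e2]
    abel
  have l1 : κ₁ ≤ P := eP ▸ Measure.le_add_left le_rfl
  have l2 : κ₂ ≤ Q := eQ ▸ Measure.le_add_left le_rfl
  have l0 : Q.restrict D + P.restrict Dᶜ ≤ P := by
    conv_rhs => rw [← eP]
    exact Measure.le_add_right le_rfl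
  have iP := hfP.integrable hp
  have iQ := hfQ.integrable hp
  have I1 : ∫ x, f x ∂P - ∫ x, f x ∂Q = ∫ x, f x ∂κ₁ - ∫ x, f x ∂κ₂ := by
    have h1 := integral_add_measure (iP.mono_measure l0) (iP.mono_measure l1)
    have h2 := integral_add_measure (iP.mono_measure l0) (iQ.mono_measure l2)
    rw [eP] at h1
    rw [eQ] at h2
    rw [h1, h2]
    abel
  have m1 : κ₁ Set.univ ≤ ENNReal.ofReal δ := by
    have := hδ D hD
    rw [hκ₁, Measure.sub_apply MeasurableSet.univ hle1, Measure.restrict_apply_univ,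
      Measure.restrict_apply_univ]
    rw [← ENNReal.ofReal_toReal (measure_ne_top P D), ← ENNReal.ofReal_toReal (measure_ne_top Q D),
      ← ENNReal.ofReal_sub _ ENNReal.toReal_nonneg]
    exact ENNReal.ofReal_le_ofReal ((le_abs_self _).trans this)
  have m2 : κ₂ Set.univ ≤ ENNReal.ofReal δ := by
    have := hδ Dᶜ hD.compl
    rw [hκ₂, Measure.sub_apply MeasurableSet.univ hle2, Measure.restrict_apply_univ,
      Measure.restrict_apply_univ]
    rw [← ENNReal.ofReal_toReal (measure_ne_top P Dᶜ),
      ← ENNReal.ofReal_toReal (measure_ne_top Q Dᶜ), ← ENNReal.ofReal_sub _ ENNReal.toReal_nonneg]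
    rw [abs_sub_comm] at this
    exact ENNReal.ofReal_le_ofReal ((le_abs_self _).trans this)
  -- For `p = ∞` the conventions `∞.toReal = 0` and `1 / 0 = 0` give the correct exponent `1`.
  have hexp : 0 ≤ 1 - 1 / p.toReal := by
    rcases eq_or_ne p ∞ with rfl | hp'
    · simp
    · have : 1 ≤ p.toReal := by
        simpa using (ENNReal.toReal_le_toReal ENNReal.one_ne_top hp').2 hp
      rw [sub_nonneg]
      exact (div_le_one (by linarith)).2 this
  have key : ∀ (κ R : Measure α), κ ≤ R → MemLp f p R → κ Set.univ ≤ ENNReal.ofReal δ →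
      ‖∫ x, f x ∂κ‖ₑ ≤ eLpNorm f p R * ENNReal.ofReal δ ^ (1 - 1 / p.toReal) := by
    intro κ R hle hf hm
    calc ‖∫ x, f x ∂κ‖ₑ ≤ ∫⁻ x, ‖f x‖ₑ ∂κ := enorm_integral_le_lintegral_enorm _
      _ = eLpNorm f 1 κ := eLpNorm_one_eq_lintegral_enorm.symm
      _ ≤ eLpNorm f p κ * κ Set.univ ^ (1 / (1 : ℝ≥0∞).toReal - 1 / p.toReal) :=
        eLpNorm_le_eLpNorm_mul_rpow_measure_univ hp (hf.1.mono_measure hle)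
      _ ≤ _ := by
        simp only [ENNReal.toReal_one, div_one]
        gcongr
  rw [I1, add_mul]
  exact enorm_sub_le.trans (add_le_add (key κ₁ P l1 hfP m1) (key κ₂ Q l2 hfQ m2))

/-! ### Mixing coefficients and laws of pairs -/

section Mixing

variable {Ω E₁ E₂ : Type*} {F₁ F₂ mΩ : MeasurableSpace Ω} {μ : Measure Ω}
  [MeasurableSpace E₁] [MeasurableSpace E₂]

/-- Labellings with values in an arbitrary finite type replace partitions indexed by `Fin`: common
refinements are then just pairs of labels. -/
theorem isFinitePartition_preimage {Ω γ : Type*} [Fintype γ] {F : MeasurableSpace Ω} {k : Ω → γ}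
    (hk : ∀ a, MeasurableSet[F] (k ⁻¹' {a})) :
    IsFinitePartition F fun i : Fin (Fintype.card γ) => k ⁻¹' {(Fintype.equivFin γ).symm i} where
  measurable i := hk _
  disjoint i j hij := Disjoint.preimage k <| Set.disjoint_singleton.2 fun h =>
    hij ((Fintype.equivFin γ).symm.injective h)
  cover := by
    ext ω
    simp only [Set.mem_iUnion, Set.mem_preimage, Set.mem_singleton_iff, Set.mem_univ, iff_true]
    exact ⟨Fintype.equivFin γ (k ω), by simp⟩

theorem sum_abs_le_of_betaCoeff_le {b : ℝ} (hb : betaCoeff μ F₁ F₂ ≤ ENNReal.ofReal b)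
    (hb0 : 0 ≤ b) {α β : Type*} [Fintype α] [Fintype β] {g : Ω → α} {h : Ω → β}
    (hg : ∀ a, MeasurableSet[F₁] (g ⁻¹' {a})) (hh : ∀ a, MeasurableSet[F₂] (h ⁻¹' {a})) :
    ∑ x : α × β, |μ.real (g ⁻¹' {x.1} ∩ h ⁻¹' {x.2})
      - μ.real (g ⁻¹' {x.1}) * μ.real (h ⁻¹' {x.2})| ≤ 2 * b := by
  have key := (le_iSup₂_of_le (Fintype.card α) (Fintype.card β) <| le_iSup₂_of_le
    (fun i => g ⁻¹' {(Fintype.equivFin α).symm i}) (fun i => h ⁻¹' {(Fintype.equivFin β).symm i}) <|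
    le_iSup₂_of_le (isFinitePartition_preimage hg) (isFinitePartition_preimage hh) le_rfl).trans hb
  rw [ENNReal.ofReal_le_ofReal_iff hb0] at key
  rw [Fintype.sum_prod_type]
  rw [← (Fintype.equivFin α).symm.sum_comp]
  simp_rw [← (Fintype.equivFin β).symm.sum_comp (fun y => _)]
  linarith

/-- The finite unions of measurable rectangles, presented through finite measurable labellings of
the two factors. -/
def rectangleUnions (E₁ E₂ : Type*) [MeasurableSpace E₁] [MeasurableSpace E₂] :
    Set (Set (E₁ × E₂)) :=
  {s | ∃ (α β : Type) (_ : Fintype α) (_ : Fintype β) (g : E₁ → α) (h : E₂ → β) (S : Set (α × β)),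
    (∀ a, MeasurableSet (g ⁻¹' {a})) ∧ (∀ a, MeasurableSet (h ⁻¹' {a})) ∧
      s = {p | (g p.1, h p.2) ∈ S}}

theorem setOf_labels_mem_eq_biUnion {E₁ E₂ α β : Type*} (g : E₁ → α) (h : E₂ → β) (S : Set (α × β)) :
    {p : E₁ × E₂ | (g p.1, h p.2) ∈ S} = ⋃ x ∈ S, (g ⁻¹' {x.1}) ×ˢ (h ⁻¹' {x.2}) := by
  ext p
  simp only [Set.mem_ofPred_eq, Set.mem_iUnion, Set.mem_prod, Set.mem_preimage,
    Set.mem_singleton_iff, exists_prop]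
  exact ⟨fun hp => ⟨_, hp, rfl, rfl⟩, fun ⟨x, hx, h1, h2⟩ => by rwa [h1, h2]⟩

theorem measurableSet_of_mem_rectangleUnions {s : Set (E₁ × E₂)}
    (hs : s ∈ rectangleUnions E₁ E₂) : MeasurableSet s := by
  obtain ⟨α, β, _, _, g, h, S, hg, hh, rfl⟩ := hs
  rw [setOf_labels_mem_eq_biUnion]
  exact MeasurableSet.biUnion (Set.to_countable S) fun x _ => (hg _).prod (hh _)

theorem prod_mem_rectangleUnions {A : Set E₁} {B : Set E₂} (hA : MeasurableSet A)
    (hB : MeasurableSet B) : A ×ˢ B ∈ rectangleUnions E₁ E₂ := by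
  classical
  -- `Prop` serves as the two-element set of labels: a point is labelled by its membership in the
  -- side of the rectangle.
  refine ⟨Prop, Prop, inferInstance, inferInstance, fun x => x ∈ A, fun x => x ∈ B,
    {(True, True)}, fun a => ?_, fun a => ?_, ?_⟩
  · exact (measurableSet_setOfPred.1 hA) (measurableSet_singleton a)
  · exact (measurableSet_setOfPred.1 hB) (measurableSet_singleton a)
  · ext p
    simp

/-- Pairing the labels of two such sets refines both partitions at once, and every Boolean
combination of the sets is then read off from the pairs of labels. -/
theorem isSetRing_rectangleUnions : IsSetRing (rectangleUnions E₁ E₂) := by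
  have comb : ∀ s ∈ rectangleUnions E₁ E₂, ∀ t ∈ rectangleUnions E₁ E₂, ∀ φ : Prop → Prop → Prop,
      {p | φ (p ∈ s) (p ∈ t)} ∈ rectangleUnions E₁ E₂ := by
    rintro s ⟨α, β, _, _, g, h, S, hg, hh, rfl⟩ t ⟨α', β', _, _, g', h', S', hg', hh', rfl⟩ φ
    refine ⟨α × α', β × β', inferInstance, inferInstance, fun x => (g x, g' x),
      fun x => (h x, h' x), {q | φ ((q.1.1, q.2.1) ∈ S) ((q.1.2, q.2.2) ∈ S')}, ?_, ?_, rfl⟩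
    · rintro ⟨a, a'⟩
      convert! (hg a).inter (hg' a') using 1
      ext x
      simp [Prod.ext_iff]
    · rintro ⟨a, a'⟩
      convert! (hh a).inter (hh' a') using 1
      ext x
      simp [Prod.ext_iff]
  refine ⟨?_, fun s t hs ht => comb s hs t ht Or, fun s t hs ht => comb s hs t ht (· ∧ ¬ ·)⟩
  simpa using prod_mem_rectangleUnions (E₁ := E₁) (E₂ := E₂) MeasurableSet.empty MeasurableSet.empty

theorem generateFrom_rectangleUnions :
    Prod.instMeasurableSpace = MeasurableSpace.generateFrom (rectangleUnions E₁ E₂) := by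
  refine le_antisymm ?_ ?_
  · rw [← generateFrom_prod]
    refine MeasurableSpace.generateFrom_mono ?_
    rintro _ ⟨A, hA, B, hB, rfl⟩
    exact prod_mem_rectangleUnions hA hB
  · exact MeasurableSpace.generateFrom_le fun s hs => measurableSet_of_mem_rectangleUnions hs

/-- For a finite union of rectangles the difference is a partial sum of the terms defining the
`β`-coefficient. A general measurable set is approximated by such unions with respect to `P + Q`,
since they form a ring generating the product `σ`-algebra. Keeping absolute values inside the sum
costs a harmless factor two. -/
theorem abs_measureReal_map_sub_prod_le [IsProbabilityMeasure μ] {b : ℝ} (hb : betaCoeff μ F₁ F₂ ≤ ENNReal.ofReal b)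
    (hb0 : 0 ≤ b) (h₁ : F₁ ≤ mΩ) (h₂ : F₂ ≤ mΩ) {U : Ω → E₁} {V : Ω → E₂}
    (hU : Measurable[F₁] U) (hV : Measurable[F₂] V) {s : Set (E₁ × E₂)} (hs : MeasurableSet s) :
    |(μ.map fun ω => (U ω, V ω)).real s - ((μ.map U).prod (μ.map V)).real s| ≤ 2 * b := by
  have hU' : Measurable U := hU.mono h₁ le_rfl
  have hV' : Measurable V := hV.mono h₂ le_rfl
  have hUV : Measurable fun ω => (U ω, V ω) := hU'.prodMk hV'
  have := Measure.isProbabilityMeasure_map (μ := μ) hU'.aemeasurable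
  have := Measure.isProbabilityMeasure_map (μ := μ) hV'.aemeasurable
  have := Measure.isProbabilityMeasure_map (μ := μ) hUV.aemeasurable
  set P := μ.map fun ω => (U ω, V ω) with hP
  set Q := (μ.map U).prod (μ.map V) with hQ
  have hrect : ∀ t ∈ rectangleUnions E₁ E₂, |P.real t - Q.real t| ≤ 2 * b := by
    classical
    rintro t ⟨α, β, _, _, g, h, S, hg, hh, rfl⟩
    have hd : (↑S.toFinset : Set (α × β)).PairwiseDisjoint
        fun x => (g ⁻¹' {x.1}) ×ˢ (h ⁻¹' {x.2}) := by
      intro x _ y _ hxy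
      refine Set.disjoint_left.2 fun p hp hp' => hxy ?_
      simp only [Set.mem_prod, Set.mem_preimage, Set.mem_singleton_iff] at hp hp'
      exact Prod.ext (hp.1.symm.trans hp'.1) (hp.2.symm.trans hp'.2)
    have e : {p : E₁ × E₂ | (g p.1, h p.2) ∈ S}
        = ⋃ x ∈ S.toFinset, (g ⁻¹' {x.1}) ×ˢ (h ⁻¹' {x.2}) := by
      rw [setOf_labels_mem_eq_biUnion]
      simp
    rw [e, measureReal_biUnion_finset hd fun x _ => (hg _).prod (hh _),
      measureReal_biUnion_finset hd fun x _ => (hg _).prod (hh _), ← Finset.sum_sub_distrib]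
    refine (Finset.abs_sum_le_sum_abs _ _).trans ?_
    refine (Finset.sum_le_univ_sum_of_nonneg fun x => abs_nonneg _).trans ?_
    refine le_trans (le_of_eq ?_) (sum_abs_le_of_betaCoeff_le hb hb0 (g := g ∘ U) (h := h ∘ V)
      (fun a => hU (hg a)) (fun a => hV (hh a)))
    refine Finset.sum_congr rfl fun x _ => ?_
    rw [hP, map_measureReal_apply hUV ((hg _).prod (hh _)), hQ, measureReal_prod_prod,
      map_measureReal_apply hU' (hg _), map_measureReal_apply hV' (hh _)]
    rfl
  refine le_of_forall_pos_le_add fun ε hε => ?_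
  obtain ⟨t, ht, hlt⟩ := exists_measure_symmDiff_lt_of_generateFrom_isSetRing (μ := P + Q)
    isSetRing_rectangleUnions ⟨{Set.univ}, Set.countable_singleton _, by
      rw [Set.singleton_subset_iff]
      simpa using prod_mem_rectangleUnions (E₁ := E₁) (E₂ := E₂) MeasurableSet.univ
        MeasurableSet.univ, by simp⟩ generateFrom_rectangleUnions hs
    (ε := ENNReal.ofReal ε) (by simpa using hε)
  have htm := measurableSet_of_mem_rectangleUnions ht
  have hlt' : P.real (symmDiff t s) + Q.real (symmDiff t s) < ε := by
    rw [← measureReal_add_apply, measureReal_def]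
    exact (ENNReal.lt_ofReal_iff_toReal_lt (measure_ne_top _ _)).1 hlt
  have d1 : |P.real t - P.real s| ≤ P.real (symmDiff t s) :=
    abs_measureReal_sub_le_measureReal_symmDiff htm.nullMeasurableSet hs.nullMeasurableSet
  have d2 : |Q.real t - Q.real s| ≤ Q.real (symmDiff t s) :=
    abs_measureReal_sub_le_measureReal_symmDiff htm.nullMeasurableSet hs.nullMeasurableSet
  have d3 := hrect t ht
  rw [abs_le] at *
  constructor <;> linarith [d1.1, d1.2, d2.1, d2.2, d3.1, d3.2]

/-- The decoupling inequality behind every mixing estimate below. Values in a normed space are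
allowed because it is applied to complex exponentials as well as to products of kernels. -/
theorem norm_integral_sub_integral_prod_le [IsProbabilityMeasure μ] {F : Type*}
    [NormedAddCommGroup F] [NormedSpace ℝ F]
    {b : ℝ} (hb : betaCoeff μ F₁ F₂ ≤ ENNReal.ofReal b)
    (hb0 : 0 ≤ b) (h₁ : F₁ ≤ mΩ) (h₂ : F₂ ≤ mΩ) {U : Ω → E₁} {V : Ω → E₂}
    (hU : Measurable[F₁] U) (hV : Measurable[F₂] V) {f : E₁ × E₂ → F} (hf : StronglyMeasurable f)
    {p : ℝ≥0∞} (hp : 1 ≤ p) {A B : ℝ} (hA0 : 0 ≤ A) (hB0 : 0 ≤ B)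
    (hA : eLpNorm (fun ω => f (U ω, V ω)) p μ ≤ ENNReal.ofReal A)
    (hB : eLpNorm f p ((μ.map U).prod (μ.map V)) ≤ ENNReal.ofReal B) :
    ‖∫ ω, f (U ω, V ω) ∂μ - ∫ x, f x ∂((μ.map U).prod (μ.map V))‖
      ≤ (A + B) * (2 * b) ^ (1 - 1 / p.toReal) := by
  have hU' : Measurable U := hU.mono h₁ le_rfl
  have hV' : Measurable V := hV.mono h₂ le_rfl
  have hUV : Measurable fun ω => (U ω, V ω) := hU'.prodMk hV'
  have := Measure.isProbabilityMeasure_map (μ := μ) hU'.aemeasurable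
  have := Measure.isProbabilityMeasure_map (μ := μ) hV'.aemeasurable
  have := Measure.isProbabilityMeasure_map (μ := μ) hUV.aemeasurable
  have hA' : eLpNorm f p (μ.map fun ω => (U ω, V ω)) ≤ ENNReal.ofReal A := by
    rwa [eLpNorm_map_measure hf.aestronglyMeasurable hUV.aemeasurable]
  have key := enorm_integral_sub_integral_le
    (fun s hs => abs_measureReal_map_sub_prod_le hb hb0 h₁ h₂ hU hV hs) hp
    (f := f) ⟨hf.aestronglyMeasurable, hA'.trans_lt ENNReal.ofReal_lt_top⟩
    ⟨hf.aestronglyMeasurable, hB.trans_lt ENNReal.ofReal_lt_top⟩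
  rw [integral_map hUV.aemeasurable hf.aestronglyMeasurable] at key
  have hexp : 0 ≤ 1 - 1 / p.toReal := by
    rcases eq_or_ne p ∞ with rfl | hp'
    · simp
    · have : 1 ≤ p.toReal := by
        simpa using (ENNReal.toReal_le_toReal ENNReal.one_ne_top hp').2 hp
      rw [sub_nonneg]
      exact (div_le_one (by linarith)).2 this
  rw [← ENNReal.ofReal_le_ofReal_iff (by positivity), ofReal_norm]
  refine key.trans ?_
  rw [ENNReal.ofReal_mul (add_nonneg hA0 hB0), ENNReal.ofReal_add hA0 hB0,
    ← ENNReal.ofReal_rpow_of_nonneg (by positivity) hexp]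
  gcongr

end Mixing

/-! ### Elementary estimates for the complex exponential -/

theorem norm_cexp_sub_one_le (u : ℝ) : ‖Complex.exp (u * Complex.I) - 1‖ ≤ |u| := by
  have := Real.norm_exp_I_mul_ofReal_sub_one_le (x := u)
  rwa [mul_comm, Real.norm_eq_abs] at this

theorem norm_cexp_sub_cexp_le (u v : ℝ) :
    ‖Complex.exp (u * Complex.I) - Complex.exp (v * Complex.I)‖ ≤ |u - v| := by
  have : Complex.exp (u * Complex.I) - Complex.exp (v * Complex.I)
      = Complex.exp (v * Complex.I) * (Complex.exp ((u - v : ℝ) * Complex.I) - 1) := by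
    rw [mul_sub, ← Complex.exp_add, mul_one]
    push_cast
    ring_nf
  rw [this, norm_mul, Complex.norm_exp_ofReal_mul_I, one_mul]
  exact norm_cexp_sub_one_le _

/-- The derivative of the left-hand function is `i (e^{ix} - 1)`, of norm at most `|x| ≤ |u|`
between `0` and `u`; the mean value inequality then gives the constant `1`, which suffices. -/
theorem norm_cexp_sub_one_sub_le (u : ℝ) :
    ‖Complex.exp (u * Complex.I) - 1 - u * Complex.I‖ ≤ u ^ 2 := by
  have hd : ∀ x : ℝ, HasDerivAt (fun x : ℝ => Complex.exp (x * Complex.I) - 1 - x * Complex.I)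
      ((Complex.exp (x * Complex.I) - 1) * Complex.I) x := by
    intro x
    have h1 : HasDerivAt (fun x : ℝ => (x : ℂ) * Complex.I) (1 * Complex.I) x :=
      (Complex.ofRealCLM.hasDerivAt (x := x)).mul_const _
    convert! (h1.cexp.sub_const 1).sub h1 using 1
    ring
  have key := Convex.norm_image_sub_le_of_norm_hasDerivWithin_le (C := |u|)
    (f := fun x : ℝ => Complex.exp (x * Complex.I) - 1 - x * Complex.I)
    (f' := fun x : ℝ => (Complex.exp (x * Complex.I) - 1) * Complex.I) (s := Set.uIcc 0 u)
    (x := 0) (y := u) (fun x _ => (hd x).hasDerivWithinAt) (fun x hx => by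
      rw [norm_mul, Complex.norm_I, mul_one]
      refine (norm_cexp_sub_one_le x).trans ?_
      simpa using Set.abs_sub_left_of_mem_uIcc hx) (convex_uIcc 0 u)
    Set.left_mem_uIcc Set.right_mem_uIcc
  simpa [abs_mul_abs_self, sq] using key

/-! ### Products of functions in `L³` -/

instance holderTriple_three_three : ENNReal.HolderTriple 3 3 (3 / 2) where
  inv_add_inv_eq_inv := by
    rw [ENNReal.inv_div (by simp) (by simp), ENNReal.div_eq_inv_mul, mul_comm, two_mul]

instance holderTriple_three_three_halves : ENNReal.HolderTriple 3 (3 / 2) 1 where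
  inv_add_inv_eq_inv := by
    rw [ENNReal.inv_div (by simp) (by simp), ENNReal.div_eq_inv_mul, inv_one]
    nth_rw 1 [← mul_one (3⁻¹ : ℝ≥0∞)]
    rw [← mul_add, show (1 : ℝ≥0∞) + 2 = 3 by norm_num, ENNReal.inv_mul_cancel] <;> simp

theorem one_le_three_halves : (1 : ℝ≥0∞) ≤ 3 / 2 := by
  rw [ENNReal.le_div_iff_mul_le (by simp) (by simp)]
  norm_num

/-- The source of all cube roots of mixing coefficients: a product of two variables in `L³` lies in
`L^(3/2)`, and decoupling at `p = 3 / 2` leaves the exponent `1 / 3`. -/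
theorem one_sub_inv_three_halves : 1 - 1 / (3 / 2 : ℝ≥0∞).toReal = 1 / 3 := by
  rw [ENNReal.toReal_div]
  norm_num

section Products

variable {Ω : Type*} [MeasurableSpace Ω] {μ : Measure Ω} {f g h : Ω → ℝ} {K : ℝ}

theorem eLpNorm_mul_le_of_three (hf : AEStronglyMeasurable f μ) (hg : AEStronglyMeasurable g μ)
    (hf3 : eLpNorm f 3 μ ≤ ENNReal.ofReal K) (hg3 : eLpNorm g 3 μ ≤ ENNReal.ofReal K)
    (hK : 0 ≤ K) : eLpNorm (fun ω => f ω * g ω) (3 / 2) μ ≤ ENNReal.ofReal (K ^ 2) := by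
  refine (eLpNorm_smul_le_mul_eLpNorm (p := 3) (q := 3) (r := 3 / 2) hg hf).trans ?_
  rw [sq, ENNReal.ofReal_mul hK]
  gcongr

theorem eLpNorm_mul_mul_le_of_three (hf : AEStronglyMeasurable f μ)
    (hg : AEStronglyMeasurable g μ) (hh : AEStronglyMeasurable h μ)
    (hf3 : eLpNorm f 3 μ ≤ ENNReal.ofReal K) (hg3 : eLpNorm g 3 μ ≤ ENNReal.ofReal K)
    (hh3 : eLpNorm h 3 μ ≤ ENNReal.ofReal K) (hK : 0 ≤ K) :
    eLpNorm (fun ω => f ω * (g ω * h ω)) 1 μ ≤ ENNReal.ofReal (K ^ 3) := by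
  refine (eLpNorm_smul_le_mul_eLpNorm (p := 3) (q := 3 / 2) (r := 1) (hg.mul hh) hf).trans ?_
  rw [pow_succ', ENNReal.ofReal_mul hK]
  gcongr
  exact eLpNorm_mul_le_of_three hg hh hg3 hh3 hK

theorem integral_abs_le_of_eLpNorm_one_le (hf : AEStronglyMeasurable f μ)
    (h : eLpNorm f 1 μ ≤ ENNReal.ofReal K) (hK : 0 ≤ K) : ∫ ω, |f ω| ∂μ ≤ K := by
  have : ∫ ω, |f ω| ∂μ = (eLpNorm f 1 μ).toReal := by
    rw [eLpNorm_one_eq_lintegral_enorm, ← integral_norm_eq_lintegral_enorm hf]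
    rfl
  rw [this]
  exact ENNReal.toReal_le_of_le_ofReal hK h

theorem integrable_of_eLpNorm_one_le (hf : AEStronglyMeasurable f μ)
    (h : eLpNorm f 1 μ ≤ ENNReal.ofReal K) : Integrable f μ :=
  memLp_one_iff_integrable.1 ⟨hf, h.trans_lt ENNReal.ofReal_lt_top⟩

end Products

/-! ### Covariance inequalities -/

section Covariance

variable {Ω : Type*} {F₁ F₂ mΩ : MeasurableSpace Ω} {μ : Measure Ω} {b : ℝ}

theorem measurable_sigmaGen {ι Ω E : Type*} [MeasurableSpace E] {X : ι → Ω → E} {J : Finset ι}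
    {i : ι} (hi : i ∈ J) : Measurable[sigmaGen X J] (X i) := by
  rw [measurable_iff_comap_le]
  exact le_iSup₂_of_le (f := fun i (_ : i ∈ J) => MeasurableSpace.comap (X i) inferInstance)
    i hi le_rfl

theorem sigmaGen_le {ι Ω E : Type*} [MeasurableSpace E] {mΩ : MeasurableSpace Ω} {X : ι → Ω → E}
    (hX : ∀ i, Measurable (X i)) (J : Finset ι) : sigmaGen X J ≤ mΩ :=
  iSup₂_le fun i _ => (hX i).comap_le

/-- Covariance inequality for a random variable with a moment and a unimodular one. -/
theorem norm_integral_mul_cexp_sub_le [IsProbabilityMeasure μ]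
    (hb : betaCoeff μ F₁ F₂ ≤ ENNReal.ofReal b) (hb0 : 0 ≤ b) (h₁ : F₁ ≤ mΩ) (h₂ : F₂ ≤ mΩ)
    {U V : Ω → ℝ} (hU : Measurable[F₁] U) (hV : Measurable[F₂] V) (t : ℝ)
    {p : ℝ≥0∞} (hp : 1 ≤ p) {A : ℝ} (hA0 : 0 ≤ A) (hA : eLpNorm U p μ ≤ ENNReal.ofReal A) :
    ‖∫ ω, (U ω : ℂ) * Complex.exp ((t * V ω : ℝ) * Complex.I) ∂μ
        - (∫ ω, U ω ∂μ : ℝ) * ∫ ω, Complex.exp ((t * V ω : ℝ) * Complex.I) ∂μ‖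
      ≤ 2 * A * (2 * b) ^ (1 - 1 / p.toReal) := by
  have hU' : Measurable U := hU.mono h₁ le_rfl
  have hV' : Measurable V := hV.mono h₂ le_rfl
  have := Measure.isProbabilityMeasure_map (μ := μ) hU'.aemeasurable
  have := Measure.isProbabilityMeasure_map (μ := μ) hV'.aemeasurable
  set f : ℝ × ℝ → ℂ := fun x => (x.1 : ℂ) * Complex.exp ((t * x.2 : ℝ) * Complex.I) with hf
  have hfm : StronglyMeasurable f := by
    apply Continuous.stronglyMeasurable
    fun_prop
  have hn : ∀ x, ‖f x‖ = ‖x.1‖ := fun x => by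
    rw [hf, norm_mul, Complex.norm_exp_ofReal_mul_I, mul_one, Complex.norm_real]
  have e1 : ∫ x, f x ∂((μ.map U).prod (μ.map V))
      = (∫ ω, U ω ∂μ : ℝ) * ∫ ω, Complex.exp ((t * V ω : ℝ) * Complex.I) ∂μ := by
    rw [hf, integral_prod_mul (fun x : ℝ => (x : ℂ))
      (fun x : ℝ => Complex.exp ((t * x : ℝ) * Complex.I))]
    rw [integral_map hU'.aemeasurable (by fun_prop), integral_map hV'.aemeasurable (by fun_prop),
      integral_complex_ofReal]
  rw [← e1]
  refine (norm_integral_sub_integral_prod_le hb hb0 h₁ h₂ hU hV hfm hp hA0 hA0 ?_ ?_).trans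
    (le_of_eq (by ring))
  · refine le_trans (le_of_eq (eLpNorm_congr_norm_ae (ae_of_all _ fun ω => ?_))) hA
    exact hn _
  · have : eLpNorm f p ((μ.map U).prod (μ.map V))
        = eLpNorm (fun x : ℝ × ℝ => x.1) p ((μ.map U).prod (μ.map V)) :=
      eLpNorm_congr_norm_ae (ae_of_all _ fun ω => hn _)
    rw [this]
    have h2 := eLpNorm_comp_measurePreserving (p := p) (g := fun x : ℝ => x)
      aestronglyMeasurable_id (measurePreserving_fst (μ := μ.map U) (ν := μ.map V))
    have h3 := eLpNorm_map_measure (p := p) (μ := μ) (f := U) (g := fun x : ℝ => x)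
      aestronglyMeasurable_id hU'.aemeasurable
    exact (h2.trans h3).trans_le hA

/-- Covariance inequality for two random variables with third moments. -/
theorem abs_integral_mul_sub_le [IsProbabilityMeasure μ]
    (hb : betaCoeff μ F₁ F₂ ≤ ENNReal.ofReal b) (hb0 : 0 ≤ b) (h₁ : F₁ ≤ mΩ) (h₂ : F₂ ≤ mΩ)
    {U V : Ω → ℝ} (hU : Measurable[F₁] U) (hV : Measurable[F₂] V)
    {K : ℝ} (hK : 0 ≤ K) (hU3 : eLpNorm U 3 μ ≤ ENNReal.ofReal K)
    (hV3 : eLpNorm V 3 μ ≤ ENNReal.ofReal K) :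
    |∫ ω, U ω * V ω ∂μ - (∫ ω, U ω ∂μ) * ∫ ω, V ω ∂μ|
      ≤ 2 * K ^ 2 * (2 * b) ^ (1 / 3 : ℝ) := by
  have hU' : Measurable U := hU.mono h₁ le_rfl
  have hV' : Measurable V := hV.mono h₂ le_rfl
  have := Measure.isProbabilityMeasure_map (μ := μ) hU'.aemeasurable
  have := Measure.isProbabilityMeasure_map (μ := μ) hV'.aemeasurable
  have e1 : ∫ x : ℝ × ℝ, x.1 * x.2 ∂((μ.map U).prod (μ.map V))
      = (∫ ω, U ω ∂μ) * ∫ ω, V ω ∂μ := by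
    rw [integral_prod_mul (fun x : ℝ => x) (fun x : ℝ => x)]
    rw [integral_map hU'.aemeasurable (by fun_prop), integral_map hV'.aemeasurable (by fun_prop)]
  have h1 := (eLpNorm_comp_measurePreserving (p := 3) (g := fun x : ℝ => x)
      aestronglyMeasurable_id (measurePreserving_fst (μ := μ.map U) (ν := μ.map V))).trans
    (eLpNorm_map_measure (p := 3) (μ := μ) (f := U) (g := fun x : ℝ => x)
      aestronglyMeasurable_id hU'.aemeasurable)
  have h2 := (eLpNorm_comp_measurePreserving (p := 3) (g := fun x : ℝ => x)
      aestronglyMeasurable_id (measurePreserving_snd (μ := μ.map U) (ν := μ.map V))).trans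
    (eLpNorm_map_measure (p := 3) (μ := μ) (f := V) (g := fun x : ℝ => x)
      aestronglyMeasurable_id hV'.aemeasurable)
  have key := norm_integral_sub_integral_prod_le (p := 3 / 2) hb hb0 h₁ h₂ hU hV
    (f := fun x : ℝ × ℝ => x.1 * x.2) (Continuous.stronglyMeasurable (by fun_prop))
    one_le_three_halves (sq_nonneg K) (sq_nonneg K)
    (eLpNorm_mul_le_of_three hU'.aestronglyMeasurable hV'.aestronglyMeasurable hU3 hV3 hK)
    (eLpNorm_mul_le_of_three measurable_fst.aestronglyMeasurable
      measurable_snd.aestronglyMeasurable (h1.trans_le hU3) (h2.trans_le hV3) hK)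
  rw [e1, one_sub_inv_three_halves, Real.norm_eq_abs] at key
  exact key.trans (le_of_eq (by ring))

end Covariance

/-! ### The approximate Stein equation for the characteristic function -/

/-- Lying outside the `m`-neighbourhood means distance greater than `m`, which is more than the
separation that `separatedPairs` requires. -/
theorem betaCoeff_le_of_sampleBeta_le {ι Ω E : Type*} [Fintype ι] [EMetricSpace ι]
    [MeasurableSpace Ω] [MeasurableSpace E] {μ : Measure Ω} {X : ι → Ω → E} {n₁ n₂ : ℕ∞}
    {m : ℝ≥0} {b : ℝ≥0∞} (hb : sampleBeta μ X n₁ n₂ m ≤ b) {J₁ J₂ : Finset ι}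
    (h₁ : (J₁.card : ℕ∞) ≤ n₁) (h₂ : (J₂.card : ℕ∞) ≤ n₂)
    (h : ∀ i ∈ J₁, ∀ j ∈ J₂, j ∉ nbhd m i) :
    betaCoeff μ (sigmaGen X J₁) (sigmaGen X J₂) ≤ b := by
  refine le_trans ?_ hb
  refine le_iSup₂_of_le (f := fun (J : Finset ι × Finset ι) (_ : J ∈ separatedPairs ι n₁ n₂ m) =>
    betaCoeff μ (sigmaGen X J.1) (sigmaGen X J.2)) (J₁, J₂) ⟨h₁, h₂, ?_⟩ le_rfl
  refine le_iInf₂ fun i hi => le_iInf₂ fun j hj => ?_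
  have := h i hi j hj
  simp only [nbhd, Finset.mem_filter, Finset.mem_univ, true_and, not_le] at this
  exact this.le

theorem mem_nbhd_comm {ι : Type*} [Fintype ι] [EMetricSpace ι] {m : ℝ≥0} {i j : ι} :
    i ∈ nbhd m j ↔ j ∈ nbhd m i := by
  simp [nbhd, edist_comm]

theorem integrable_mul_cexp {Ω : Type*} [MeasurableSpace Ω] {μ : Measure Ω} {f V : Ω → ℝ}
    (hf : Integrable f μ) (hV : AEMeasurable V μ) (t : ℝ) :
    Integrable (fun ω => (f ω : ℂ) * Complex.exp ((t * V ω : ℝ) * Complex.I)) μ := by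
  refine hf.mono ?_ (ae_of_all _ fun ω => ?_)
  · have := hf.aestronglyMeasurable.aemeasurable
    exact AEMeasurable.aestronglyMeasurable (by fun_prop)
  · rw [norm_mul, Complex.norm_exp_ofReal_mul_I, mul_one, Complex.norm_real]

section Stein

variable {ι Ω E : Type*} [Fintype ι] [EMetricSpace ι] [MeasurableSpace E] {mΩ : MeasurableSpace Ω}
  {μ : Measure Ω} [IsProbabilityMeasure μ] {X : ι → Ω → E} {ξ : ι → Ω → ℝ} {K b : ℝ}
  {m : ℝ≥0} {η : ℕ}

omit [Fintype ι] [EMetricSpace ι] in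
theorem measurable_sum_sigmaGen (hξ : ∀ i J, i ∈ J → Measurable[sigmaGen X J] (ξ i))
    (S : Finset ι) : Measurable[sigmaGen X S] fun ω => ∑ l ∈ S, ξ l ω :=
  Finset.measurable_fun_sum S fun l hl => hξ l S hl

/-- Removing the neighbourhood of a node from the sum, to second order. -/
theorem norm_integral_mul_cexp_sub_sum_le (hX : ∀ i, Measurable (X i))
    (hξ : ∀ i J, i ∈ J → Measurable[sigmaGen X J] (ξ i)) (hK : 0 ≤ K)
    (hξ3 : ∀ i, eLpNorm (ξ i) 3 μ ≤ ENNReal.ofReal K) (hξ0 : ∀ i, ∫ ω, ξ i ω ∂μ = 0)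
    (hη : ∀ i : ι, (nbhd m i).card ≤ η) (hb0 : 0 ≤ b)
    (hb : sampleBeta μ X 2 ⊤ m ≤ ENNReal.ofReal b) (t : ℝ) (i : ι) :
    ‖∫ ω, (ξ i ω : ℂ) * Complex.exp ((t * ∑ l, ξ l ω : ℝ) * Complex.I) ∂μ
      - ∑ j ∈ nbhd m i, (t * Complex.I) * ∫ ω, ((ξ i ω * ξ j ω : ℝ) : ℂ)
        * Complex.exp ((t * ∑ l, ξ l ω : ℝ) * Complex.I) ∂μ‖
      ≤ 2 * K * (2 * b) ^ (1 / 2 : ℝ) + t ^ 2 * (η ^ 2 * K ^ 3) := by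
  classical
  have hm : ∀ j, Measurable (ξ j) := fun j =>
    (hξ j {j} (Finset.mem_singleton_self j)).mono (sigmaGen_le hX _) le_rfl
  have hsm : ∀ j, AEStronglyMeasurable (ξ j) μ := fun j => (hm j).aestronglyMeasurable
  have hi3 : ∀ j l, Integrable (fun ω => ξ i ω * (ξ j ω * ξ l ω)) μ := fun j l =>
    integrable_of_eLpNorm_one_le ((hsm i).mul ((hsm j).mul (hsm l)))
      (eLpNorm_mul_mul_le_of_three (hsm i) (hsm j) (hsm l) (hξ3 i) (hξ3 j) (hξ3 l) hK)
  have hi2 : ∀ j, Integrable (fun ω => ξ i ω * ξ j ω) μ := fun j =>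
    MemLp.integrable one_le_three_halves ⟨(hsm i).mul (hsm j),
      (eLpNorm_mul_le_of_three (hsm i) (hsm j) (hξ3 i) (hξ3 j) hK).trans_lt ENNReal.ofReal_lt_top⟩
  have hi1 : Integrable (ξ i) μ := MemLp.integrable (by norm_num)
    ⟨hsm i, (hξ3 i).trans_lt ENNReal.ofReal_lt_top⟩
  set N := nbhd m i with hN
  set W : Ω → ℝ := fun ω => ∑ l, ξ l ω with hW
  set V : Ω → ℝ := fun ω => ∑ l ∈ Nᶜ, ξ l ω with hV
  set T : Ω → ℝ := fun ω => ∑ l ∈ N, ξ l ω with hT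
  have hWm : Measurable W := Finset.measurable_fun_sum _ fun l _ => hm l
  have hVm : Measurable V := Finset.measurable_fun_sum _ fun l _ => hm l
  have hWV : ∀ ω, W ω = T ω + V ω := fun ω => (Finset.sum_add_sum_compl N _).symm
  -- The variable `ξ i` is centred and `i` is separated from `Nᶜ`, so the expectation of `ξ i` times
  -- `e^{itV}` nearly vanishes. The choice `p = 2` gives the exponent `1 / 2`, hence `√(n β)` after
  -- summing over `n` nodes with `K` of order `n^(-1/2)`.
  have hcov := norm_integral_mul_cexp_sub_le (p := 2)
    (betaCoeff_le_of_sampleBeta_le hb (J₁ := {i}) (J₂ := Nᶜ) (by simp) le_top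
      (by simp [hN])) hb0 (sigmaGen_le hX _) (sigmaGen_le hX _) (hξ i {i} (by simp))
    (measurable_sum_sigmaGen hξ Nᶜ) t (by norm_num) hK
    ((eLpNorm_le_eLpNorm_of_exponent_le (by norm_num) (hsm i)).trans (hξ3 i))
  rw [hξ0 i, Complex.ofReal_zero, zero_mul, sub_zero,
    show (1 : ℝ) - 1 / (2 : ℝ≥0∞).toReal = 1 / 2 by norm_num] at hcov
  have hR : ‖∫ ω, ((ξ i ω : ℂ) * Complex.exp ((t * W ω : ℝ) * Complex.I)
      - ∑ j ∈ N, (t * Complex.I) * (((ξ i ω * ξ j ω : ℝ) : ℂ)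
        * Complex.exp ((t * W ω : ℝ) * Complex.I))
      - (ξ i ω : ℂ) * Complex.exp ((t * V ω : ℝ) * Complex.I)) ∂μ‖ ≤ t ^ 2 * (η ^ 2 * K ^ 3) := by
    have hbd : ∀ ω, ‖(ξ i ω : ℂ) * Complex.exp ((t * W ω : ℝ) * Complex.I)
      - ∑ j ∈ N, (t * Complex.I) * (((ξ i ω * ξ j ω : ℝ) : ℂ)
        * Complex.exp ((t * W ω : ℝ) * Complex.I))
      - (ξ i ω : ℂ) * Complex.exp ((t * V ω : ℝ) * Complex.I)‖
        ≤ t ^ 2 * ∑ j ∈ N, ∑ l ∈ N, |ξ i ω * (ξ j ω * ξ l ω)| := by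
      intro ω
      have e1 : ∑ j ∈ N, (t * Complex.I) * (((ξ i ω * ξ j ω : ℝ) : ℂ)
          * Complex.exp ((t * W ω : ℝ) * Complex.I))
          = (t * Complex.I) * ξ i ω * T ω * Complex.exp ((t * W ω : ℝ) * Complex.I) := by
        rw [hT]
        push_cast
        rw [Finset.mul_sum, Finset.sum_mul]
        exact Finset.sum_congr rfl fun j _ => by ring
      have e2 : Complex.exp ((t * V ω : ℝ) * Complex.I) = Complex.exp ((t * W ω : ℝ) * Complex.I)
          * Complex.exp ((-(t * T ω) : ℝ) * Complex.I) := by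
        rw [← Complex.exp_add, hWV]
        push_cast
        ring_nf
      -- The expansion is made around `W` rather than `V`, so that the products `ξ i * ξ j` come
      -- with the full exponential.
      have e3 : (ξ i ω : ℂ) * Complex.exp ((t * W ω : ℝ) * Complex.I)
          - (t * Complex.I) * ξ i ω * T ω * Complex.exp ((t * W ω : ℝ) * Complex.I)
          - (ξ i ω : ℂ) * (Complex.exp ((t * W ω : ℝ) * Complex.I)
          * Complex.exp ((-(t * T ω) : ℝ) * Complex.I))
          = -((ξ i ω : ℂ) * Complex.exp ((t * W ω : ℝ) * Complex.I)
            * (Complex.exp ((-(t * T ω) : ℝ) * Complex.I) - 1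
              - (-(t * T ω) : ℝ) * Complex.I)) := by
        push_cast
        ring
      rw [e1, e2, e3, norm_neg, norm_mul, norm_mul, Complex.norm_exp_ofReal_mul_I, mul_one,
        Complex.norm_real, Real.norm_eq_abs]
      calc |ξ i ω| * _ ≤ |ξ i ω| * (-(t * T ω)) ^ 2 :=
            mul_le_mul_of_nonneg_left (norm_cexp_sub_one_sub_le _) (abs_nonneg _)
        _ = t ^ 2 * (|ξ i ω| * |T ω * T ω|) := by
            rw [abs_mul_self]
            ring
        _ ≤ t ^ 2 * (|ξ i ω| * ∑ j ∈ N, ∑ l ∈ N, |ξ j ω * ξ l ω|) := by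
            gcongr
            rw [hT, Finset.sum_mul_sum]
            exact (Finset.abs_sum_le_sum_abs _ _).trans
              (Finset.sum_le_sum fun j _ => Finset.abs_sum_le_sum_abs _ _)
        _ = _ := by
            simp_rw [Finset.mul_sum, abs_mul]
    have hint : Integrable (fun ω => t ^ 2 * ∑ j ∈ N, ∑ l ∈ N, |ξ i ω * (ξ j ω * ξ l ω)|) μ :=
      (integrable_finsetSum _ fun j _ => integrable_finsetSum _ fun l _ =>
        (hi3 j l).abs).const_mul _
    refine (norm_integral_le_of_norm_le hint (ae_of_all _ hbd)).trans ?_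
    rw [integral_const_mul, integral_finsetSum _ fun j _ =>
      integrable_finsetSum _ fun l _ => (hi3 j l).abs]
    gcongr
    calc ∑ j ∈ N, ∫ ω, ∑ l ∈ N, |ξ i ω * (ξ j ω * ξ l ω)| ∂μ
        ≤ ∑ j ∈ N, ∑ l ∈ N, K ^ 3 := by
          refine Finset.sum_le_sum fun j _ => ?_
          rw [integral_finsetSum _ fun l _ => (hi3 j l).abs]
          exact Finset.sum_le_sum fun l _ => integral_abs_le_of_eLpNorm_one_le
            ((hsm i).mul ((hsm j).mul (hsm l)))
            (eLpNorm_mul_mul_le_of_three (hsm i) (hsm j) (hsm l) (hξ3 i) (hξ3 j) (hξ3 l) hK)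
            (by positivity)
      _ = (N.card : ℝ) ^ 2 * K ^ 3 := by
          simp
          ring
      _ ≤ η ^ 2 * K ^ 3 := by
          gcongr
          exact hη i
  have hc : ∀ j, Integrable (fun ω => (t * Complex.I) * (((ξ i ω * ξ j ω : ℝ) : ℂ)
        * Complex.exp ((t * W ω : ℝ) * Complex.I))) μ := fun j =>
    (integrable_mul_cexp (hi2 j) hWm.aemeasurable t).const_mul _
  have hcs := integrable_finsetSum N fun j _ => hc j
  have hw := integrable_mul_cexp hi1 hWm.aemeasurable t
  have hwc : Integrable (fun ω => (ξ i ω : ℂ) * Complex.exp ((t * W ω : ℝ) * Complex.I)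
      - ∑ j ∈ N, (t * Complex.I) * (((ξ i ω * ξ j ω : ℝ) : ℂ)
        * Complex.exp ((t * W ω : ℝ) * Complex.I))) μ := hw.sub hcs
  rw [integral_sub hwc (integrable_mul_cexp hi1 hVm.aemeasurable t),
    integral_sub hw hcs, integral_finsetSum _ fun j _ => hc j] at hR
  simp_rw [integral_const_mul] at hR
  calc _ = ‖_ + ∫ ω, (ξ i ω : ℂ) * Complex.exp ((t * V ω : ℝ) * Complex.I) ∂μ‖ := by
        rw [sub_add_cancel]
    _ ≤ _ := norm_add_le _ _
    _ ≤ _ := by rw [add_comm]; exact add_le_add hcov hR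

/-- Decorrelating a product of two variables from the exponential of the sum. -/
theorem norm_integral_mul_mul_cexp_sub_le (hX : ∀ i, Measurable (X i))
    (hξ : ∀ i J, i ∈ J → Measurable[sigmaGen X J] (ξ i)) (hK : 0 ≤ K)
    (hξ3 : ∀ i, eLpNorm (ξ i) 3 μ ≤ ENNReal.ofReal K)
    (hη : ∀ i : ι, (nbhd m i).card ≤ η) (hb0 : 0 ≤ b)
    (hb : sampleBeta μ X 2 ⊤ m ≤ ENNReal.ofReal b) (t : ℝ) (i j : ι) :
    ‖∫ ω, ((ξ i ω * ξ j ω : ℝ) : ℂ) * Complex.exp ((t * ∑ l, ξ l ω : ℝ) * Complex.I) ∂μ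
      - (∫ ω, ξ i ω * ξ j ω ∂μ : ℝ) * ∫ ω, Complex.exp ((t * ∑ l, ξ l ω : ℝ) * Complex.I) ∂μ‖
      ≤ 2 * K ^ 2 * (2 * b) ^ (1 / 3 : ℝ) + |t| * (4 * η * K ^ 3) := by
  classical
  have hm : ∀ j, Measurable (ξ j) := fun j =>
    (hξ j {j} (Finset.mem_singleton_self j)).mono (sigmaGen_le hX _) le_rfl
  have hsm : ∀ j, AEStronglyMeasurable (ξ j) μ := fun j => (hm j).aestronglyMeasurable
  have hl3 : ∀ l, eLpNorm (fun ω => ξ l ω * (ξ i ω * ξ j ω)) 1 μ ≤ ENNReal.ofReal (K ^ 3) :=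
    fun l => eLpNorm_mul_mul_le_of_three (hsm l) (hsm i) (hsm j) (hξ3 l) (hξ3 i) (hξ3 j) hK
  have hi3 : ∀ l, Integrable (fun ω => ξ l ω * (ξ i ω * ξ j ω)) μ := fun l =>
    integrable_of_eLpNorm_one_le ((hsm l).mul ((hsm i).mul (hsm j))) (hl3 l)
  have hl2 := eLpNorm_mul_le_of_three (hsm i) (hsm j) (hξ3 i) (hξ3 j) hK
  have hi2 : Integrable (fun ω => ξ i ω * ξ j ω) μ :=
    MemLp.integrable one_le_three_halves ⟨(hsm i).mul (hsm j), hl2.trans_lt ENNReal.ofReal_lt_top⟩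
  have hl1 : ∀ l, eLpNorm (ξ l) 1 μ ≤ ENNReal.ofReal K := fun l =>
    (eLpNorm_le_eLpNorm_of_exponent_le (by norm_num) (hsm l)).trans (hξ3 l)
  have hi1 : ∀ l, Integrable (ξ l) μ := fun l => integrable_of_eLpNorm_one_le (hsm l) (hl1 l)
  -- Three comparisons follow: `W` is replaced by the sum `V` off both neighbourhoods, the product
  -- is decoupled from `e^{itV}`, and `V` is put back to `W` in the mean of the exponential. Each of
  -- the two replacements costs `2 * η * K ^ 3` times `|t|`, since `N` has at most `2 * η` nodes.
  set N := nbhd m i ∪ nbhd m j with hN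
  have hNcard : (N.card : ℝ) ≤ 2 * η := by
    have := (Finset.card_union_le (nbhd m i) (nbhd m j)).trans (add_le_add (hη i) (hη j))
    rw [two_mul]
    exact_mod_cast this
  set W : Ω → ℝ := fun ω => ∑ l, ξ l ω with hW
  set V : Ω → ℝ := fun ω => ∑ l ∈ Nᶜ, ξ l ω with hV
  have hWm : Measurable W := Finset.measurable_fun_sum _ fun l _ => hm l
  have hVm : Measurable V := Finset.measurable_fun_sum _ fun l _ => hm l
  have hJ : Measurable[sigmaGen X {i, j}] fun ω => ξ i ω * ξ j ω :=
    Measurable.mul (hξ i {i, j} (by simp)) (hξ j {i, j} (by simp))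
  have hcov := norm_integral_mul_cexp_sub_le (p := 3 / 2)
    (betaCoeff_le_of_sampleBeta_le hb (J₁ := {i, j}) (J₂ := Nᶜ)
      (by exact_mod_cast Finset.card_le_two) le_top
      (by simp +contextual [hN])) hb0 (sigmaGen_le hX _) (sigmaGen_le hX _) hJ
    (measurable_sum_sigmaGen hξ Nᶜ) t one_le_three_halves (sq_nonneg K) hl2
  rw [one_sub_inv_three_halves] at hcov
  have hdiff : ∀ ω, ‖Complex.exp ((t * W ω : ℝ) * Complex.I)
      - Complex.exp ((t * V ω : ℝ) * Complex.I)‖ ≤ |t| * ∑ l ∈ N, |ξ l ω| := by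
    intro ω
    refine (norm_cexp_sub_cexp_le _ _).trans ?_
    have : t * W ω - t * V ω = t * ∑ l ∈ N, ξ l ω := by
      rw [hW, hV, ← mul_sub]
      congr 1
      rw [sub_eq_iff_eq_add]
      exact (Finset.sum_add_sum_compl N _).symm
    rw [this, abs_mul]
    gcongr
    exact Finset.abs_sum_le_sum_abs _ _
  have hce : ∀ {Z : Ω → ℝ}, Measurable Z →
      Integrable (fun ω => Complex.exp ((t * Z ω : ℝ) * Complex.I)) μ := fun {Z} hZ => by
    simpa using integrable_mul_cexp (integrable_const (1 : ℝ)) hZ.aemeasurable t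
  have h1 : ‖∫ ω, ((ξ i ω * ξ j ω : ℝ) : ℂ) * Complex.exp ((t * W ω : ℝ) * Complex.I) ∂μ
      - ∫ ω, ((ξ i ω * ξ j ω : ℝ) : ℂ) * Complex.exp ((t * V ω : ℝ) * Complex.I) ∂μ‖
      ≤ |t| * (2 * η * K ^ 3) := by
    rw [← integral_sub (integrable_mul_cexp hi2 hWm.aemeasurable t)
      (integrable_mul_cexp hi2 hVm.aemeasurable t)]
    have hint : Integrable (fun ω => |t| * ∑ l ∈ N, |ξ l ω * (ξ i ω * ξ j ω)|) μ :=
      (integrable_finsetSum _ fun l _ => (hi3 l).abs).const_mul _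
    refine (norm_integral_le_of_norm_le hint (ae_of_all _ fun ω => ?_)).trans ?_
    · rw [← mul_sub, norm_mul, Complex.norm_real, Real.norm_eq_abs]
      refine (mul_le_mul_of_nonneg_left (hdiff ω) (abs_nonneg _)).trans (le_of_eq ?_)
      simp_rw [abs_mul, Finset.mul_sum]
      exact Finset.sum_congr rfl fun l _ => by ring
    · rw [integral_const_mul, integral_finsetSum _ fun l _ => (hi3 l).abs]
      gcongr
      calc _ ≤ ∑ l ∈ N, K ^ 3 := Finset.sum_le_sum fun l _ =>
            integral_abs_le_of_eLpNorm_one_le ((hsm l).mul ((hsm i).mul (hsm j))) (hl3 l)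
              (by positivity)
        _ = N.card * K ^ 3 := by simp
        _ ≤ _ := by gcongr
  have h2 : ‖∫ ω, Complex.exp ((t * V ω : ℝ) * Complex.I) ∂μ
      - ∫ ω, Complex.exp ((t * W ω : ℝ) * Complex.I) ∂μ‖ ≤ |t| * (2 * η * K) := by
    rw [← norm_neg, neg_sub, ← integral_sub (hce hWm) (hce hVm)]
    have hint : Integrable (fun ω => |t| * ∑ l ∈ N, |ξ l ω|) μ :=
      (integrable_finsetSum _ fun l _ => (hi1 l).abs).const_mul _
    refine (norm_integral_le_of_norm_le hint (ae_of_all _ hdiff)).trans ?_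
    rw [integral_const_mul, integral_finsetSum _ fun l _ => (hi1 l).abs]
    gcongr
    calc _ ≤ ∑ l ∈ N, K := Finset.sum_le_sum fun l _ =>
          integral_abs_le_of_eLpNorm_one_le (hsm l) (hl1 l) hK
      _ = N.card * K := by simp
      _ ≤ _ := by gcongr
  have h3 : |∫ ω, ξ i ω * ξ j ω ∂μ| ≤ K ^ 2 :=
    (abs_integral_le_integral_abs).trans (integral_abs_le_of_eLpNorm_one_le
      ((hsm i).mul (hsm j)) ((eLpNorm_le_eLpNorm_of_exponent_le one_le_three_halves
        ((hsm i).mul (hsm j))).trans hl2) (sq_nonneg K))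
  set a := ∫ ω, ξ i ω * ξ j ω ∂μ with ha
  have h4 : ‖(a : ℂ) * (∫ ω, Complex.exp ((t * V ω : ℝ) * Complex.I) ∂μ
      - ∫ ω, Complex.exp ((t * W ω : ℝ) * Complex.I) ∂μ)‖ ≤ K ^ 2 * (|t| * (2 * η * K)) := by
    rw [norm_mul, Complex.norm_real, Real.norm_eq_abs]
    exact mul_le_mul h3 h2 (norm_nonneg _) (sq_nonneg K)
  refine le_trans (le_of_eq ?_) ((norm_add₃_le (a := _) (b := _) (c := _)).trans
    ((add_le_add_three h1 hcov h4).trans (le_of_eq (by ring))))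
  congr 1
  ring

/-- The approximate Stein equation. -/
theorem norm_integral_sum_mul_cexp_sub_le (hX : ∀ i, Measurable (X i))
    (hξ : ∀ i J, i ∈ J → Measurable[sigmaGen X J] (ξ i)) (hK : 0 ≤ K)
    (hξ3 : ∀ i, eLpNorm (ξ i) 3 μ ≤ ENNReal.ofReal K) (hξ0 : ∀ i, ∫ ω, ξ i ω ∂μ = 0)
    (hη : ∀ i : ι, (nbhd m i).card ≤ η) {b₁ b₂ : ℝ} (hb10 : 0 ≤ b₁) (hb20 : 0 ≤ b₂)
    (hb1 : sampleBeta μ X 1 3 m ≤ ENNReal.ofReal b₁)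
    (hb2 : sampleBeta μ X 2 ⊤ m ≤ ENNReal.ofReal b₂)
    (hvar : ∫ ω, (∑ i, ξ i ω) ^ 2 ∂μ = 1) (t : ℝ) :
    ‖∫ ω, ((∑ i, ξ i ω : ℝ) : ℂ) * Complex.exp ((t * ∑ l, ξ l ω : ℝ) * Complex.I) ∂μ
      - (t * Complex.I) * ∫ ω, Complex.exp ((t * ∑ l, ξ l ω : ℝ) * Complex.I) ∂μ‖
      ≤ Fintype.card ι * (2 * K * (2 * b₂) ^ (1 / 2 : ℝ) + t ^ 2 * (η ^ 2 * K ^ 3))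
        + |t| * (Fintype.card ι * η *
          (2 * K ^ 2 * (2 * b₂) ^ (1 / 3 : ℝ) + |t| * (4 * η * K ^ 3)))
        + |t| * (Fintype.card ι ^ 2 * (2 * K ^ 2 * (2 * b₁) ^ (1 / 3 : ℝ))) := by
  classical
  have hm : ∀ j, Measurable (ξ j) := fun j =>
    (hξ j {j} (Finset.mem_singleton_self j)).mono (sigmaGen_le hX _) le_rfl
  have hsm : ∀ j, AEStronglyMeasurable (ξ j) μ := fun j => (hm j).aestronglyMeasurable
  have hi2 : ∀ i j, Integrable (fun ω => ξ i ω * ξ j ω) μ := fun i j =>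
    MemLp.integrable one_le_three_halves ⟨(hsm i).mul (hsm j),
      (eLpNorm_mul_le_of_three (hsm i) (hsm j) (hξ3 i) (hξ3 j) hK).trans_lt ENNReal.ofReal_lt_top⟩
  have hi1 : ∀ i, Integrable (ξ i) μ := fun i => MemLp.integrable (by norm_num)
    ⟨hsm i, (hξ3 i).trans_lt ENNReal.ofReal_lt_top⟩
  set W : Ω → ℝ := fun ω => ∑ l, ξ l ω with hW
  have hWm : Measurable W := Finset.measurable_fun_sum _ fun l _ => hm l
  set φ := ∫ ω, Complex.exp ((t * W ω : ℝ) * Complex.I) ∂μ with hφ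
  have hφ1 : ‖φ‖ ≤ 1 := by
    refine (norm_integral_le_of_norm_le_const (C := 1) (ae_of_all _ fun ω => ?_)).trans (by simp)
    rw [Complex.norm_exp_ofReal_mul_I]
  set A : ι → ℂ := fun i => ∫ ω, (ξ i ω : ℂ) * Complex.exp ((t * W ω : ℝ) * Complex.I) ∂μ with hA
  set B : ι → ι → ℂ := fun i j => ∫ ω, ((ξ i ω * ξ j ω : ℝ) : ℂ)
    * Complex.exp ((t * W ω : ℝ) * Complex.I) ∂μ with hB
  set c : ι → ι → ℝ := fun i j => ∫ ω, ξ i ω * ξ j ω ∂μ with hc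
  have s0 : ∫ ω, ((W ω : ℝ) : ℂ) * Complex.exp ((t * W ω : ℝ) * Complex.I) ∂μ = ∑ i, A i := by
    rw [hA, ← integral_finsetSum _ fun i _ => integrable_mul_cexp (hi1 i) hWm.aemeasurable t]
    refine integral_congr_ae (ae_of_all _ fun ω => ?_)
    simp only [hW, Complex.ofReal_sum, Finset.sum_mul]
  have s1 : ‖∑ i, (A i - ∑ j ∈ nbhd m i, (t * Complex.I) * B i j)‖
      ≤ Fintype.card ι * (2 * K * (2 * b₂) ^ (1 / 2 : ℝ) + t ^ 2 * (η ^ 2 * K ^ 3)) := by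
    refine (norm_sum_le_of_le _ fun i _ =>
      norm_integral_mul_cexp_sub_sum_le hX hξ hK hξ3 hξ0 hη hb20 hb2 t i).trans ?_
    rw [Finset.sum_const, nsmul_eq_mul, Finset.card_univ]
  have s2 : ‖∑ i, ∑ j ∈ nbhd m i, (t * Complex.I) * (B i j - c i j * φ)‖
      ≤ |t| * (Fintype.card ι * η *
          (2 * K ^ 2 * (2 * b₂) ^ (1 / 3 : ℝ) + |t| * (4 * η * K ^ 3))) := by
    simp_rw [← Finset.mul_sum]
    rw [norm_mul, norm_mul, Complex.norm_I, mul_one, Complex.norm_real, Real.norm_eq_abs]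
    gcongr
    calc _ ≤ ∑ i : ι, (η : ℝ) *
          (2 * K ^ 2 * (2 * b₂) ^ (1 / 3 : ℝ) + |t| * (4 * η * K ^ 3)) := by
          refine norm_sum_le_of_le _ fun i _ => ?_
          refine (norm_sum_le_of_le _ fun j _ =>
            norm_integral_mul_mul_cexp_sub_le hX hξ hK hξ3 hη hb20 hb2 t i j).trans ?_
          rw [Finset.sum_const, nsmul_eq_mul]
          gcongr
          exact hη i
      _ = _ := by
          rw [Finset.sum_const, nsmul_eq_mul, Finset.card_univ]
          ring
  have s3 : ∑ i, ∑ j, c i j = 1 := by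
    rw [← hvar, hc]
    simp_rw [sq, Finset.sum_mul_sum]
    rw [integral_finsetSum _ fun i _ => integrable_finsetSum _ fun j _ => hi2 i j]
    exact Finset.sum_congr rfl fun i _ => (integral_finsetSum _ fun j _ => hi2 i j).symm
  -- The unit variance is the sum of all covariances, so the neighbourhoods miss only the
  -- covariances of separated pairs. There are at most `n²` of them, each controlled by the mixing
  -- coefficient.
  have s4 : |∑ i, ∑ j ∈ nbhd m i, c i j - 1|
      ≤ Fintype.card ι ^ 2 * (2 * K ^ 2 * (2 * b₁) ^ (1 / 3 : ℝ)) := by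
    have : ∑ i, ∑ j ∈ nbhd m i, c i j - 1 = -∑ i, ∑ j ∈ (nbhd m i)ᶜ, c i j := by
      rw [← s3, ← Finset.sum_sub_distrib, ← Finset.sum_neg_distrib]
      refine Finset.sum_congr rfl fun i _ => ?_
      rw [← Finset.sum_add_sum_compl (nbhd m i)]
      ring
    rw [this, abs_neg]
    calc _ ≤ ∑ i : ι, (Fintype.card ι : ℝ) * (2 * K ^ 2 * (2 * b₁) ^ (1 / 3 : ℝ)) := by
          refine (Finset.abs_sum_le_sum_abs _ _).trans (Finset.sum_le_sum fun i _ => ?_)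
          refine (Finset.abs_sum_le_sum_abs _ _).trans ?_
          refine (Finset.sum_le_sum (g := fun _ => 2 * K ^ 2 * (2 * b₁) ^ (1 / 3 : ℝ))
            fun j hj => ?_).trans ?_
          · have := abs_integral_mul_sub_le
              (betaCoeff_le_of_sampleBeta_le hb1 (J₁ := {i}) (J₂ := {j}) (by simp) (by simp)
                (by simpa using hj)) hb10 (sigmaGen_le hX _) (sigmaGen_le hX _)
              (hξ i {i} (by simp)) (hξ j {j} (by simp)) hK (hξ3 i) (hξ3 j)
            simpa [hξ0] using this
          · rw [Finset.sum_const, nsmul_eq_mul]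
            gcongr
            exact Finset.card_le_univ _
      _ = _ := by
          rw [Finset.sum_const, nsmul_eq_mul, Finset.card_univ]
          ring
  have s5 : ‖(t * Complex.I) * ((∑ i, ∑ j ∈ nbhd m i, c i j - 1 : ℝ) * φ)‖
      ≤ |t| * (Fintype.card ι ^ 2 * (2 * K ^ 2 * (2 * b₁) ^ (1 / 3 : ℝ))) := by
    rw [norm_mul, norm_mul, norm_mul, Complex.norm_I, mul_one, Complex.norm_real, Complex.norm_real,
      Real.norm_eq_abs, Real.norm_eq_abs]
    refine mul_le_mul_of_nonneg_left ?_ (abs_nonneg t)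
    exact (mul_le_of_le_one_right (abs_nonneg _) hφ1).trans s4
  refine le_trans (le_of_eq ?_) ((norm_add₃_le (a := _) (b := _) (c := _)).trans
    (add_le_add_three s1 s2 s5))
  rw [s0]
  congr 1
  simp only [Finset.sum_sub_distrib, mul_sub, Complex.ofReal_sub, Complex.ofReal_sum,
    Complex.ofReal_one, sub_mul, Finset.sum_mul, Finset.mul_sum, one_mul]
  ring

end Stein

/-! ### From the approximate Stein equation to the characteristic function -/

section CharFun

variable {Ω : Type*} [MeasurableSpace Ω] {μ : Measure Ω} [IsProbabilityMeasure μ] {W : Ω → ℝ}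

theorem hasDerivAt_integral_cexp (hWm : Measurable W) (hW : Integrable W μ) (t : ℝ) :
    HasDerivAt (fun s : ℝ => ∫ ω, Complex.exp ((s * W ω : ℝ) * Complex.I) ∂μ)
      (∫ ω, Complex.I * ((W ω : ℂ) * Complex.exp ((t * W ω : ℝ) * Complex.I)) ∂μ) t := by
  refine (hasDerivAt_integral_of_dominated_loc_of_deriv_le (bound := fun ω => |W ω|)
    (F := fun (s : ℝ) ω => Complex.exp ((s * W ω : ℝ) * Complex.I))
    (F' := fun (s : ℝ) ω => Complex.I * ((W ω : ℂ) * Complex.exp ((s * W ω : ℝ) * Complex.I)))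
    Filter.univ_mem (Eventually.of_forall fun s => ?_) ?_ ?_ (ae_of_all _ fun ω s _ => ?_) hW.abs
    (ae_of_all _ fun ω s _ => ?_)).2
  · exact Measurable.aestronglyMeasurable (by fun_prop)
  · simpa using integrable_mul_cexp (integrable_const (1 : ℝ)) hWm.aemeasurable t
  · exact Measurable.aestronglyMeasurable (by fun_prop)
  · rw [norm_mul, Complex.norm_I, one_mul, norm_mul, Complex.norm_exp_ofReal_mul_I, mul_one,
      Complex.norm_real, Real.norm_eq_abs]
  · have h1 : HasDerivAt (fun s : ℝ => ((s * W ω : ℝ) : ℂ) * Complex.I)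
        ((W ω : ℂ) * Complex.I) s := by
      have := ((hasDerivAt_id s).mul_const (W ω)).ofReal_comp.mul_const Complex.I
      simpa using this
    convert! h1.cexp using 1
    ring

/-- The integrating factor `e^{s²/2}` turns the approximate equation `φ' = -s φ` into a small
derivative of `φ e^{s²/2}`. Its increment from `0` to `t` is at most `|t|` times the bound, and
multiplying by `e^{-t²/2}` cancels the growth of the factor. -/
theorem norm_integral_cexp_sub_le (hWm : Measurable W) (hW : Integrable W μ) {ε : ℝ} (hε : 0 ≤ ε)
    (h : ∀ t : ℝ, ‖∫ ω, (W ω : ℂ) * Complex.exp ((t * W ω : ℝ) * Complex.I) ∂μ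
      - (t * Complex.I) * ∫ ω, Complex.exp ((t * W ω : ℝ) * Complex.I) ∂μ‖ ≤ ε * (1 + |t|) ^ 2)
    (t : ℝ) :
    ‖∫ ω, Complex.exp ((t * W ω : ℝ) * Complex.I) ∂μ - Complex.exp (-(t ^ 2 / 2))‖
      ≤ ε * (1 + |t|) ^ 2 * |t| := by
  set φ : ℝ → ℂ := fun s => ∫ ω, Complex.exp ((s * W ω : ℝ) * Complex.I) ∂μ with hφ
  set D : ℝ → ℂ := fun s => ∫ ω, (W ω : ℂ) * Complex.exp ((s * W ω : ℝ) * Complex.I) ∂μ with hD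
  have hd : ∀ s : ℝ, HasDerivAt (fun s : ℝ => φ s * Complex.exp ((s ^ 2 / 2 : ℝ) : ℂ))
      (Complex.I * (D s - s * Complex.I * φ s) * Complex.exp ((s ^ 2 / 2 : ℝ) : ℂ)) s := by
    intro s
    have h1 : HasDerivAt (fun s : ℝ => ((s ^ 2 / 2 : ℝ) : ℂ)) (s : ℂ) s := by
      have := ((hasDerivAt_pow 2 s).div_const 2).ofReal_comp
      simpa using this
    have h2 := (hasDerivAt_integral_cexp hWm hW s).mul h1.cexp
    rw [integral_const_mul] at h2
    convert! h2 using 1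
    linear_combination (-(s : ℂ) * φ s * Complex.exp ((s ^ 2 / 2 : ℝ) : ℂ)) * Complex.I_sq
  have key := Convex.norm_image_sub_le_of_norm_hasDerivWithin_le
    (C := ε * (1 + |t|) ^ 2 * Real.exp (t ^ 2 / 2)) (s := Set.uIcc 0 t) (x := 0) (y := t)
    (fun s _ => (hd s).hasDerivWithinAt) (fun s hs => by
      have hst : |s| ≤ |t| := by simpa using Set.abs_sub_left_of_mem_uIcc hs
      rw [norm_mul, norm_mul, Complex.norm_I, one_mul, ← Complex.ofReal_exp, Complex.norm_real,
        Real.norm_eq_abs, Real.abs_exp]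
      have h3 : s ^ 2 ≤ t ^ 2 := sq_le_sq.2 hst
      gcongr
      exact (h s).trans (by gcongr)) (convex_uIcc 0 t) Set.left_mem_uIcc Set.right_mem_uIcc
  have hφ0 : φ 0 = 1 := by simp [hφ]
  have e : φ t - Complex.exp (-(t ^ 2 / 2))
      = (φ t * Complex.exp ((t ^ 2 / 2 : ℝ) : ℂ) - φ 0 * Complex.exp (((0 : ℝ) ^ 2 / 2 : ℝ) : ℂ))
        * Complex.exp (-(t ^ 2 / 2)) := by
    rw [hφ0, sub_mul, mul_assoc, ← Complex.exp_add]
    push_cast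
    simp
  have hn : ‖Complex.exp (-((t : ℂ) ^ 2 / 2))‖ = Real.exp (-(t ^ 2 / 2)) := by
    rw [← Real.abs_exp, ← Real.norm_eq_abs, ← Complex.norm_real]
    push_cast
    rfl
  rw [e, norm_mul, hn]
  refine (mul_le_mul_of_nonneg_right key (Real.exp_pos _).le).trans (le_of_eq ?_)
  rw [sub_zero, Real.norm_eq_abs, Real.exp_neg]
  field_simp

/-- Stability of the characteristic function under perturbations small in `L²`. -/
theorem norm_integral_cexp_sub_integral_cexp_le {Z : Ω → ℝ} (hZ : Measurable Z)
    (hWm : Measurable W) {δ : ℝ} (hi : Integrable (fun ω => (Z ω - W ω) ^ 2) μ)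
    (hδ : ∫ ω, (Z ω - W ω) ^ 2 ∂μ ≤ δ) (t : ℝ) :
    ‖∫ ω, Complex.exp ((t * Z ω : ℝ) * Complex.I) ∂μ
      - ∫ ω, Complex.exp ((t * W ω : ℝ) * Complex.I) ∂μ‖ ≤ |t| * √δ := by
  have hce : ∀ {Z : Ω → ℝ}, Measurable Z →
      Integrable (fun ω => Complex.exp ((t * Z ω : ℝ) * Complex.I)) μ := fun {Z} hZ => by
    simpa using integrable_mul_cexp (integrable_const (1 : ℝ)) hZ.aemeasurable t
  have hL : MemLp (fun ω => Z ω - W ω) 2 μ :=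
    (memLp_two_iff_integrable_sq (hZ.sub hWm).aestronglyMeasurable).2 hi
  have h1 : Integrable (fun ω => Z ω - W ω) μ := hL.integrable (by norm_num)
  rw [← integral_sub (hce hZ) (hce hWm)]
  refine (norm_integral_le_of_norm_le (h1.abs.const_mul |t|) (ae_of_all _ fun ω => ?_)).trans ?_
  · refine (norm_cexp_sub_cexp_le _ _).trans (le_of_eq ?_)
    rw [← mul_sub, abs_mul]
  · rw [integral_const_mul]
    gcongr
    -- The inequality `(𝔼|Z - W|)² ≤ 𝔼(Z - W)²` is the nonnegativity of the variance of `|Z - W|`.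
    refine Real.le_sqrt_of_sq_le (le_trans ?_ hδ)
    have hv := variance_nonneg (fun ω => |Z ω - W ω|) μ
    have hL' : MemLp (fun ω => |Z ω - W ω|) 2 μ := hL.abs
    rw [variance_eq_sub hL'] at hv
    simpa using hv

end CharFun

/-! ### Counting tuples without isolated indices -/

section Counting

variable {ι : Type*} [Fintype ι]

/-- With `c` an indicator of closeness: whichever of `a`, `b`, `y` is close to `x`, one of the two
variables has `n` choices and the other at most `η`. -/
theorem sum_sum_close_le {c : ι → ι → ℝ} {η : ℝ} (hs : ∀ i j, c i j = c j i)
    (hη : ∀ i, ∑ j, c i j ≤ η) (a b : ι) :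
    ∑ x, ∑ y, (c x a + c x b + c x y) ≤ 3 * Fintype.card ι * η := by
  simp_rw [Finset.sum_add_distrib, Finset.sum_const, nsmul_eq_mul, ← Finset.mul_sum]
  have h1 : ∀ a, ∑ x, c x a ≤ η := fun a => by
    simp_rw [hs _ a]
    exact hη a
  have h2 : ∑ x, ∑ y, c x y ≤ Fintype.card ι * η := by
    refine (Finset.sum_le_sum fun x _ => hη x).trans ?_
    simp
  have h3 := mul_le_mul_of_nonneg_left (h1 a) (Nat.cast_nonneg (Fintype.card ι) : (0 : ℝ) ≤ _)
  have h4 := mul_le_mul_of_nonneg_left (h1 b) (Nat.cast_nonneg (Fintype.card ι) : (0 : ℝ) ≤ _)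
  rw [Finset.card_univ]
  linarith

/-- A bound for the sum of an array over quadruples, when the entries are small at quadruples
having an index which is not close to any of the three others. -/
theorem sum_quadruple_le {c : ι → ι → Prop} [DecidableRel c] {η : ℕ} (hs : ∀ i j, c i j ↔ c j i)
    (hη : ∀ i, (Finset.univ.filter fun j => c i j).card ≤ η) {B : ι → ι → ι → ι → ℝ} {M δ : ℝ}
    (hM : 0 ≤ M) (hδ : 0 ≤ δ) (hB : ∀ i k j l, B i k j l ≤ M)
    (hi : ∀ i k j l, ¬ c i k → ¬ c i j → ¬ c i l → B i k j l ≤ δ)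
    (hk : ∀ i k j l, ¬ c k i → ¬ c k j → ¬ c k l → B i k j l ≤ δ)
    (hj : ∀ i k j l, ¬ c j i → ¬ c j k → ¬ c j l → B i k j l ≤ δ) :
    ∑ i, ∑ k, ∑ j, ∑ l, B i k j l
      ≤ (Fintype.card ι : ℝ) ^ 4 * δ + 9 * M * (Fintype.card ι * η) ^ 2 := by
  set e : ι → ι → ℝ := fun i j => if c i j then 1 else 0 with he
  have hes : ∀ i j, e i j = e j i := fun i j => by simp only [he, hs i j]
  have he0 : ∀ i j, 0 ≤ e i j := fun i j => by simp only [he]; split_ifs <;> norm_num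
  have heη : ∀ i, ∑ j, e i j ≤ η := fun i => by
    simp only [he, Finset.sum_boole]
    exact_mod_cast hη i
  -- If none of `i`, `k`, `j` is isolated, `i` has a close partner. When it is `k`, the node `j`
  -- still needs a partner; when it is `j` or `l`, the node `k` does. The three cases with three
  -- partners each give the constant `9`. Isolation of `l` need not be considered.
  have hpt : ∀ i k j l, B i k j l ≤ δ + M * (e i k * (e j i + e j k + e j l)
      + e i j * (e k i + e k j + e k l) + e i l * (e k i + e k l + e k j)) := by
    intro i k j l
    have n1 : 0 ≤ e i k * (e j i + e j k + e j l) := by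
      have := he0 i k; have := he0 j i; have := he0 j k; have := he0 j l; positivity
    have n2 : 0 ≤ e i j * (e k i + e k j + e k l) := by
      have := he0 i j; have := he0 k i; have := he0 k j; have := he0 k l; positivity
    have n3 : 0 ≤ e i l * (e k i + e k l + e k j) := by
      have := he0 i l; have := he0 k i; have := he0 k j; have := he0 k l; positivity
    have easy : B i k j l ≤ δ → B i k j l ≤ δ + M * (e i k * (e j i + e j k + e j l)
      + e i j * (e k i + e k j + e k l) + e i l * (e k i + e k l + e k j)) := fun h =>
      h.trans (le_add_of_nonneg_right (mul_nonneg hM (by linarith)))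
    have hard : 1 ≤ e i k * (e j i + e j k + e j l)
      + e i j * (e k i + e k j + e k l) + e i l * (e k i + e k l + e k j) →
      B i k j l ≤ δ + M * (e i k * (e j i + e j k + e j l)
      + e i j * (e k i + e k j + e k l) + e i l * (e k i + e k l + e k j)) := fun h => by
      have := mul_le_mul_of_nonneg_left h hM
      linarith [hB i k j l]
    have one : ∀ {x y}, c x y → e x y = 1 := fun h => by simp [he, h]
    by_cases h1 : ¬ c i k ∧ ¬ c i j ∧ ¬ c i l
    · exact easy (hi _ _ _ _ h1.1 h1.2.1 h1.2.2)
    by_cases h2 : ¬ c k i ∧ ¬ c k j ∧ ¬ c k l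
    · exact easy (hk _ _ _ _ h2.1 h2.2.1 h2.2.2)
    by_cases h3 : ¬ c j i ∧ ¬ c j k ∧ ¬ c j l
    · exact easy (hj _ _ _ _ h3.1 h3.2.1 h3.2.2)
    apply hard
    have h2' : 1 ≤ e k i + e k j + e k l := by
      have := he0 k i; have := he0 k j; have := he0 k l
      by_cases a1 : c k i
      · linarith [one a1]
      by_cases a2 : c k j
      · linarith [one a2]
      · linarith [one (not_not.1 fun a3 => h2 ⟨a1, a2, a3⟩)]
    have h3' : 1 ≤ e j i + e j k + e j l := by
      have := he0 j i; have := he0 j k; have := he0 j l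
      by_cases a1 : c j i
      · linarith [one a1]
      by_cases a2 : c j k
      · linarith [one a2]
      · linarith [one (not_not.1 fun a3 => h3 ⟨a1, a2, a3⟩)]
    by_cases a1 : c i k
    · rw [one a1] at n1 ⊢; linarith
    by_cases a2 : c i j
    · rw [one a2] at n2 ⊢; linarith
    · have a3 := not_not.1 fun a3 => h1 ⟨a1, a2, a3⟩
      rw [one a3] at n3 ⊢; linarith
  have pair : ∑ a, ∑ b, e a b * (3 * Fintype.card ι * η) ≤ 3 * (Fintype.card ι * η : ℝ) ^ 2 := by
    simp_rw [← Finset.sum_mul]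
    calc _ ≤ (∑ _a : ι, (η : ℝ)) * (3 * Fintype.card ι * η) := by
          gcongr
          exact heη _
      _ = _ := by
          rw [Finset.sum_const, nsmul_eq_mul, Finset.card_univ]
          ring
  have tri : ∑ a, ∑ b, e a b * ∑ x, ∑ y, (e x a + e x b + e x y)
      ≤ 3 * (Fintype.card ι * η : ℝ) ^ 2 := by
    refine le_trans ?_ pair
    exact Finset.sum_le_sum fun a _ => Finset.sum_le_sum fun b _ =>
      mul_le_mul_of_nonneg_left (sum_sum_close_le hes heη a b) (he0 a b)
  have t1 : ∑ i, ∑ k, ∑ j, ∑ l, e i k * (e j i + e j k + e j l)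
      ≤ 3 * (Fintype.card ι * η : ℝ) ^ 2 := by
    simpa only [Finset.mul_sum] using tri
  have t2 : ∑ i, ∑ k, ∑ j, ∑ l, e i j * (e k i + e k j + e k l)
      ≤ 3 * (Fintype.card ι * η : ℝ) ^ 2 := by
    refine le_trans (le_of_eq ?_) tri
    refine Finset.sum_congr rfl fun i _ => ?_
    rw [Finset.sum_comm]
    simp only [Finset.mul_sum]
  have t3 : ∑ i, ∑ k, ∑ j, ∑ l, e i l * (e k i + e k l + e k j)
      ≤ 3 * (Fintype.card ι * η : ℝ) ^ 2 := by
    refine le_trans (le_of_eq ?_) tri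
    refine Finset.sum_congr rfl fun i _ => ?_
    have : ∀ k, ∑ j, ∑ l, e i l * (e k i + e k l + e k j)
        = ∑ l, ∑ j, e i l * (e k i + e k l + e k j) := fun k => Finset.sum_comm
    simp_rw [this]
    rw [Finset.sum_comm]
    simp only [Finset.mul_sum]
  calc _ ≤ ∑ i, ∑ k, ∑ j, ∑ l, (δ + M * (e i k * (e j i + e j k + e j l)
      + e i j * (e k i + e k j + e k l) + e i l * (e k i + e k l + e k j))) :=
        Finset.sum_le_sum fun i _ => Finset.sum_le_sum fun k _ => Finset.sum_le_sum fun j _ =>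
          Finset.sum_le_sum fun l _ => hpt i k j l
    _ = (Fintype.card ι : ℝ) ^ 4 * δ
        + M * (∑ i, ∑ k, ∑ j, ∑ l, e i k * (e j i + e j k + e j l)
          + ∑ i, ∑ k, ∑ j, ∑ l, e i j * (e k i + e k j + e k l)
          + ∑ i, ∑ k, ∑ j, ∑ l, e i l * (e k i + e k l + e k j)) := by
        rw [← Finset.sum_add_distrib, ← Finset.sum_add_distrib, Finset.mul_sum]
        simp only [← Finset.sum_add_distrib, Finset.mul_sum]
        simp only [Finset.sum_add_distrib, Finset.sum_const, Finset.card_univ, nsmul_eq_mul]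
        ring
    _ ≤ _ := by
        have := mul_le_mul_of_nonneg_left (add_le_add_three t1 t2 t3) hM
        linarith

end Counting

/-! ### The kernel, its projections and the degenerate part -/

section Kernel

/-- Averaging over one variable contracts `L^p`: on each section the norm of the mean is at most the
`L^p` norm, because `ν₂` is a probability measure. -/
theorem eLpNorm_integral_right_le {α β : Type*} [MeasurableSpace α] [MeasurableSpace β]
    {ν₁ : Measure α} {ν₂ : Measure β} [IsProbabilityMeasure ν₂] {f : α → β → ℝ}
    (hf : Measurable (Function.uncurry f)) {p : ℝ≥0∞} (hp : 1 ≤ p) (hp' : p ≠ ∞) :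
    eLpNorm (fun x => ∫ y, f x y ∂ν₂) p ν₁ ≤ eLpNorm (Function.uncurry f) p (ν₁.prod ν₂) := by
  have hp0 : p ≠ 0 := (zero_lt_one.trans_le hp).ne'
  have hpos : 0 < p.toReal := ENNReal.toReal_pos hp0 hp'
  rw [eLpNorm_eq_lintegral_rpow_enorm_toReal hp0 hp', eLpNorm_eq_lintegral_rpow_enorm_toReal hp0 hp']
  gcongr
  rw [lintegral_prod _ (by fun_prop)]
  refine lintegral_mono fun x => ?_
  have h1 : ‖∫ y, f x y ∂ν₂‖ₑ ≤ (∫⁻ y, ‖f x y‖ₑ ^ p.toReal ∂ν₂) ^ (1 / p.toReal) := by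
    rw [← eLpNorm_eq_lintegral_rpow_enorm_toReal hp0 hp']
    refine (enorm_integral_le_lintegral_enorm _).trans ?_
    rw [← eLpNorm_one_eq_lintegral_enorm]
    exact eLpNorm_le_eLpNorm_of_exponent_le hp
      (hf.comp measurable_prodMk_left).aestronglyMeasurable
  refine (ENNReal.rpow_le_rpow h1 hpos.le).trans (le_of_eq ?_)
  rw [← ENNReal.rpow_mul, one_div, inv_mul_cancel₀ hpos.ne', ENNReal.rpow_one]
  rfl

variable {ι Ω E : Type*} [MeasurableSpace Ω] [MeasurableSpace E] {μ : Measure Ω}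
  {X : ι → Ω → E} {H : E → E → ℝ} {C : ℝ}

/-- The completely degenerate part of the kernel for the pair of nodes `i`, `k`. -/
noncomputable def degKernel (μ : Measure Ω) (X : ι → Ω → E) (H : E → E → ℝ) (i k : ι) (x y : E) : ℝ :=
  H x y - kernelProj μ X H k x - kernelProj μ X H i y + kernelMean μ X H i k

theorem max_eLpNorm_kernel_le (hC : sampleKernelNorm μ X H 3 ≤ ENNReal.ofReal C) {i k : ι}
    (hik : i ≠ k) :
    max (eLpNorm (fun ω => H (X i ω) (X k ω)) 3 μ)
      (eLpNorm (Function.uncurry H) 3 ((μ.map (X i)).prod (μ.map (X k)))) ≤ ENNReal.ofReal C :=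
  le_trans (le_iSup_of_le i (le_iSup₂_of_le (f := fun (j : ι) (_ : i ≠ j) =>
    max (eLpNorm (fun ω => H (X i ω) (X j ω)) 3 μ)
      (eLpNorm (Function.uncurry H) 3 ((μ.map (X i)).prod (μ.map (X j))))) k hik le_rfl)) hC

theorem eLpNorm_kernel_le (hC : sampleKernelNorm μ X H 3 ≤ ENNReal.ofReal C) {i k : ι}
    (hik : i ≠ k) : eLpNorm (fun ω => H (X i ω) (X k ω)) 3 μ ≤ ENNReal.ofReal C :=
  (max_le_iff.1 (max_eLpNorm_kernel_le hC hik)).1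

theorem eLpNorm_uncurry_kernel_le (hC : sampleKernelNorm μ X H 3 ≤ ENNReal.ofReal C) {i k : ι}
    (hik : i ≠ k) :
    eLpNorm (Function.uncurry H) 3 ((μ.map (X i)).prod (μ.map (X k))) ≤ ENNReal.ofReal C :=
  (max_le_iff.1 (max_eLpNorm_kernel_le hC hik)).2

variable [IsProbabilityMeasure μ]

theorem measurable_kernelProj (hX : ∀ i, Measurable (X i)) (hH : Measurable (Function.uncurry H))
    (k : ι) : Measurable (kernelProj μ X H k) := by
  have : Measurable (Function.uncurry fun (x : E) (ω : Ω) => H (X k ω) x) :=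
    hH.comp (((hX k).comp measurable_snd).prodMk measurable_fst)
  exact this.stronglyMeasurable.integral_prod_right.measurable

theorem measurable_degKernel (hX : ∀ i, Measurable (X i)) (hH : Measurable (Function.uncurry H))
    (i k : ι) : Measurable (Function.uncurry (degKernel μ X H i k)) := by
  have h1 := measurable_kernelProj (μ := μ) hX hH k
  have h2 := measurable_kernelProj (μ := μ) hX hH i
  exact ((hH.sub (h1.comp measurable_fst)).sub (h2.comp measurable_snd)).add measurable_const

omit [IsProbabilityMeasure μ] in
theorem kernelProj_eq_integral_map (hX : ∀ i, Measurable (X i))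
    (hH : Measurable (Function.uncurry H)) (k : ι) (x : E) :
    kernelProj μ X H k x = ∫ y, H y x ∂(μ.map (X k)) :=
  (integral_map (hX k).aemeasurable
    (hH.comp measurable_prodMk_right).aestronglyMeasurable).symm

theorem kernelMean_eq_integral_map (hX : ∀ i, Measurable (X i))
    (hH : Measurable (Function.uncurry H)) (i k : ι) :
    kernelMean μ X H i k = ∫ x, kernelProj μ X H k x ∂(μ.map (X i)) :=
  (integral_map (hX i).aemeasurable (measurable_kernelProj hX hH k).aestronglyMeasurable).symm

theorem eLpNorm_kernelProj_le (hX : ∀ i, Measurable (X i)) (hH : Measurable (Function.uncurry H))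
    (hs : ∀ x y, H x y = H y x) (hC : sampleKernelNorm μ X H 3 ≤ ENNReal.ofReal C) {i k : ι}
    (hik : i ≠ k) : eLpNorm (kernelProj μ X H k) 3 (μ.map (X i)) ≤ ENNReal.ofReal C := by
  have := Measure.isProbabilityMeasure_map (μ := μ) (hX k).aemeasurable
  refine le_trans ?_ (eLpNorm_uncurry_kernel_le hC hik)
  refine le_trans (le_of_eq ?_) (eLpNorm_integral_right_le hH (by norm_num) (by norm_num))
  congr 1
  ext x
  rw [kernelProj_eq_integral_map hX hH]
  simp_rw [hs x]

theorem abs_kernelMean_le (hX : ∀ i, Measurable (X i)) (hH : Measurable (Function.uncurry H))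
    (hs : ∀ x y, H x y = H y x) (hC0 : 0 ≤ C)
    (hC : sampleKernelNorm μ X H 3 ≤ ENNReal.ofReal C) {i k : ι}
    (hik : i ≠ k) : |kernelMean μ X H i k| ≤ C := by
  have := Measure.isProbabilityMeasure_map (μ := μ) (hX i).aemeasurable
  rw [kernelMean_eq_integral_map hX hH]
  have hm := (measurable_kernelProj (μ := μ) hX hH k).aestronglyMeasurable (μ := μ.map (X i))
  exact abs_integral_le_integral_abs.trans (integral_abs_le_of_eLpNorm_one_le hm
    ((eLpNorm_le_eLpNorm_of_exponent_le (by norm_num) hm).trans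
      (eLpNorm_kernelProj_le hX hH hs hC hik)) hC0)

theorem integrable_uncurry_kernel (hX : ∀ i, Measurable (X i))
    (hH : Measurable (Function.uncurry H))
    (hC : sampleKernelNorm μ X H 3 ≤ ENNReal.ofReal C) {i k : ι} (hik : i ≠ k) :
    Integrable (Function.uncurry H) ((μ.map (X i)).prod (μ.map (X k))) := by
  have := Measure.isProbabilityMeasure_map (μ := μ) (hX i).aemeasurable
  have := Measure.isProbabilityMeasure_map (μ := μ) (hX k).aemeasurable
  exact MemLp.integrable (q := 3) (by norm_num) ⟨hH.aestronglyMeasurable,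
    (eLpNorm_uncurry_kernel_le hC hik).trans_lt ENNReal.ofReal_lt_top⟩

/-- Fubini's theorem and the symmetry of the kernel; `i ≠ k` is what makes the kernel integrable
under the product law. -/
theorem kernelMean_comm (hX : ∀ i, Measurable (X i)) (hH : Measurable (Function.uncurry H))
    (hs : ∀ x y, H x y = H y x) (hC : sampleKernelNorm μ X H 3 ≤ ENNReal.ofReal C) {i k : ι}
    (hik : i ≠ k) : kernelMean μ X H i k = kernelMean μ X H k i := by
  have := Measure.isProbabilityMeasure_map (μ := μ) (hX i).aemeasurable
  have := Measure.isProbabilityMeasure_map (μ := μ) (hX k).aemeasurable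
  simp_rw [kernelMean_eq_integral_map hX hH, kernelProj_eq_integral_map hX hH]
  rw [integral_integral_swap (f := fun y x => H x y)]
  · simp_rw [fun x y => hs x y]
  · have := integrable_uncurry_kernel hX hH hC hik.symm
    have h2 := this.swap
    exact h2

theorem degKernel_comm (hX : ∀ i, Measurable (X i)) (hH : Measurable (Function.uncurry H))
    (hs : ∀ x y, H x y = H y x) (hC : sampleKernelNorm μ X H 3 ≤ ENNReal.ofReal C) {i k : ι}
    (hik : i ≠ k) (x y : E) : degKernel μ X H i k x y = degKernel μ X H k i y x := by
  rw [degKernel, degKernel, kernelMean_comm hX hH hs hC hik, hs x y]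
  ring

/-- Subtracting both projections and adding back the mean leaves nothing after integrating out `x`.
The claim is almost sure because the sections of the kernel are only almost all known to be
integrable. -/
theorem ae_integral_degKernel_eq_zero (hX : ∀ i, Measurable (X i))
    (hH : Measurable (Function.uncurry H)) (hs : ∀ x y, H x y = H y x)
    (hC : sampleKernelNorm μ X H 3 ≤ ENNReal.ofReal C) {i k : ι} (hik : i ≠ k) :
    ∀ᵐ y ∂(μ.map (X k)), ∫ x, degKernel μ X H i k x y ∂(μ.map (X i)) = 0 := by
  have := Measure.isProbabilityMeasure_map (μ := μ) (hX i).aemeasurable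
  have := Measure.isProbabilityMeasure_map (μ := μ) (hX k).aemeasurable
  have hp : Integrable (kernelProj μ X H k) (μ.map (X i)) :=
    MemLp.integrable (q := 3) (by norm_num)
      ⟨(measurable_kernelProj hX hH k).aestronglyMeasurable,
        (eLpNorm_kernelProj_le hX hH hs hC hik).trans_lt ENNReal.ofReal_lt_top⟩
  filter_upwards [(integrable_uncurry_kernel hX hH hC hik).prod_left_ae] with y hy
  have hy' : Integrable (fun x => H x y) (μ.map (X i)) := hy
  simp only [degKernel]
  have hd : Integrable (fun x => H x y - kernelProj μ X H k x) (μ.map (X i)) := hy'.sub hp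
  have hd' : Integrable (fun x => H x y - kernelProj μ X H k x - kernelProj μ X H i y)
    (μ.map (X i)) := hd.sub (integrable_const _)
  rw [integral_add hd' (integrable_const _), integral_sub hd (integrable_const _)]
  have : ∫ x, (H x y - kernelProj μ X H k x) ∂(μ.map (X i))
      = kernelProj μ X H i y - kernelMean μ X H i k := by
    rw [integral_sub hy' hp, ← kernelProj_eq_integral_map hX hH,
      ← kernelMean_eq_integral_map hX hH]
  simp [this]

theorem eLpNorm_sub_sub_add_le {α : Type*} [MeasurableSpace α] {ν : Measure α} {f g h k : α → ℝ}
    (hf : AEStronglyMeasurable f ν) (hg : AEStronglyMeasurable g ν)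
    (hh : AEStronglyMeasurable h ν) (hk : AEStronglyMeasurable k ν) {p : ℝ≥0∞} (hp : 1 ≤ p)
    (hC0 : 0 ≤ C) (hf' : eLpNorm f p ν ≤ ENNReal.ofReal C) (hg' : eLpNorm g p ν ≤ ENNReal.ofReal C)
    (hh' : eLpNorm h p ν ≤ ENNReal.ofReal C) (hk' : eLpNorm k p ν ≤ ENNReal.ofReal C) :
    eLpNorm (fun x => f x - g x - h x + k x) p ν ≤ ENNReal.ofReal (4 * C) := by
  rw [show 4 * C = C + C + C + C by ring, ENNReal.ofReal_add (by positivity) hC0,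
    ENNReal.ofReal_add (by positivity) hC0, ENNReal.ofReal_add hC0 hC0]
  refine (eLpNorm_add_le ((hf.sub hg).sub hh) hk hp).trans (add_le_add ?_ hk')
  refine (eLpNorm_sub_le (hf.sub hg) hh hp).trans (add_le_add ?_ hh')
  exact (eLpNorm_sub_le hf hg hp).trans (add_le_add hf' hg')

theorem eLpNorm_const_kernelMean_le (hX : ∀ i, Measurable (X i))
    (hH : Measurable (Function.uncurry H)) (hs : ∀ x y, H x y = H y x) (hC0 : 0 ≤ C)
    (hC : sampleKernelNorm μ X H 3 ≤ ENNReal.ofReal C) {i k : ι} (hik : i ≠ k)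
    {α : Type*} [MeasurableSpace α] (ν : Measure α) [IsProbabilityMeasure ν] :
    eLpNorm (fun _ : α => kernelMean μ X H i k) 3 ν ≤ ENNReal.ofReal C := by
  rw [eLpNorm_const _ (by norm_num) (IsProbabilityMeasure.ne_zero ν)]
  simp only [measure_univ, ENNReal.one_rpow, mul_one]
  rw [← ofReal_norm, Real.norm_eq_abs]
  exact ENNReal.ofReal_le_ofReal (abs_kernelMean_le hX hH hs hC0 hC hik)

theorem eLpNorm_kernelProj_comp_le (hX : ∀ i, Measurable (X i))
    (hH : Measurable (Function.uncurry H)) (hs : ∀ x y, H x y = H y x)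
    (hC : sampleKernelNorm μ X H 3 ≤ ENNReal.ofReal C) {i k : ι} (hik : i ≠ k) :
    eLpNorm (fun ω => kernelProj μ X H k (X i ω)) 3 μ ≤ ENNReal.ofReal C :=
  (eLpNorm_map_measure (measurable_kernelProj hX hH k).aestronglyMeasurable
    (hX i).aemeasurable).symm.trans_le (eLpNorm_kernelProj_le hX hH hs hC hik)

theorem eLpNorm_degKernel_comp_le (hX : ∀ i, Measurable (X i))
    (hH : Measurable (Function.uncurry H)) (hs : ∀ x y, H x y = H y x) (hC0 : 0 ≤ C)
    (hC : sampleKernelNorm μ X H 3 ≤ ENNReal.ofReal C) {i k : ι} (hik : i ≠ k) :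
    eLpNorm (fun ω => degKernel μ X H i k (X i ω) (X k ω)) 3 μ ≤ ENNReal.ofReal (4 * C) :=
  eLpNorm_sub_sub_add_le (hH.comp ((hX i).prodMk (hX k))).aestronglyMeasurable
    ((measurable_kernelProj hX hH k).comp (hX i)).aestronglyMeasurable
    ((measurable_kernelProj hX hH i).comp (hX k)).aestronglyMeasurable
    aestronglyMeasurable_const (by norm_num) hC0 (eLpNorm_kernel_le hC hik)
    (eLpNorm_kernelProj_comp_le hX hH hs hC hik) (eLpNorm_kernelProj_comp_le hX hH hs hC hik.symm)
    (eLpNorm_const_kernelMean_le hX hH hs hC0 hC hik μ)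

theorem eLpNorm_uncurry_degKernel_le (hX : ∀ i, Measurable (X i))
    (hH : Measurable (Function.uncurry H)) (hs : ∀ x y, H x y = H y x) (hC0 : 0 ≤ C)
    (hC : sampleKernelNorm μ X H 3 ≤ ENNReal.ofReal C) {i k : ι} (hik : i ≠ k) :
    eLpNorm (Function.uncurry (degKernel μ X H i k)) 3 ((μ.map (X i)).prod (μ.map (X k)))
      ≤ ENNReal.ofReal (4 * C) := by
  have := Measure.isProbabilityMeasure_map (μ := μ) (hX i).aemeasurable
  have := Measure.isProbabilityMeasure_map (μ := μ) (hX k).aemeasurable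
  refine eLpNorm_sub_sub_add_le (f := Function.uncurry H) (g := fun x => kernelProj μ X H k x.1)
    (h := fun x => kernelProj μ X H i x.2) (k := fun _ => kernelMean μ X H i k)
    hH.aestronglyMeasurable ((measurable_kernelProj hX hH k).comp measurable_fst).aestronglyMeasurable
    ((measurable_kernelProj hX hH i).comp measurable_snd).aestronglyMeasurable
    aestronglyMeasurable_const (by norm_num) hC0 (eLpNorm_uncurry_kernel_le hC hik) ?_ ?_
    (eLpNorm_const_kernelMean_le hX hH hs hC0 hC hik _)
  · exact (eLpNorm_comp_measurePreserving (measurable_kernelProj hX hH k).aestronglyMeasurable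
      measurePreserving_fst).trans_le (eLpNorm_kernelProj_le hX hH hs hC hik)
  · exact (eLpNorm_comp_measurePreserving (measurable_kernelProj hX hH i).aestronglyMeasurable
      measurePreserving_snd).trans_le (eLpNorm_kernelProj_le hX hH hs hC hik.symm)

/-- The products of degenerate kernels are nearly uncorrelated when one of the nodes is isolated. -/
theorem abs_integral_degKernel_mul_le [Fintype ι] [EMetricSpace ι] {m : ℝ≥0} {b : ℝ}
    (hX : ∀ i, Measurable (X i))
    (hH : Measurable (Function.uncurry H)) (hs : ∀ x y, H x y = H y x) (hC0 : 0 ≤ C)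
    (hC : sampleKernelNorm μ X H 3 ≤ ENNReal.ofReal C) (hb0 : 0 ≤ b)
    (hb : sampleBeta μ X 1 3 m ≤ ENNReal.ofReal b) {i k j l : ι} (hik : i ≠ k) (hjl : j ≠ l)
    (h1 : k ∉ nbhd m i) (h2 : j ∉ nbhd m i) (h3 : l ∉ nbhd m i) :
    |∫ ω, degKernel μ X H i k (X i ω) (X k ω) * degKernel μ X H j l (X j ω) (X l ω) ∂μ|
      ≤ 2 * (4 * C) ^ 2 * (2 * b) ^ (1 / 3 : ℝ) := by
  classical
  -- The nodes `k`, `j`, `l` form the second group. They may coincide with each other, but none is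
  -- `i`, so only the first kernel involves `X i`.
  set V : Ω → E × E × E := fun ω => (X k ω, X j ω, X l ω) with hV
  have hVm : Measurable V := (hX k).prodMk ((hX j).prodMk (hX l))
  have hVs : Measurable[sigmaGen X {k, j, l}] V :=
    Measurable.prodMk (measurable_sigmaGen (by simp))
      (Measurable.prodMk (measurable_sigmaGen (by simp)) (measurable_sigmaGen (by simp)))
  have := Measure.isProbabilityMeasure_map (μ := μ) (hX i).aemeasurable
  have := Measure.isProbabilityMeasure_map (μ := μ) (hX k).aemeasurable
  have := Measure.isProbabilityMeasure_map (μ := μ) hVm.aemeasurable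
  have hG1 := measurable_degKernel (μ := μ) hX hH i k
  have hG2 := measurable_degKernel (μ := μ) hX hH j l
  set g₁ : E × E × E × E → ℝ := fun q => degKernel μ X H i k q.1 q.2.1 with hg₁
  set g₂ : E × E × E × E → ℝ := fun q => degKernel μ X H j l q.2.2.1 q.2.2.2 with hg₂
  have hm1 : Measurable g₁ := hG1.comp (measurable_fst.prodMk measurable_snd.fst)
  have hm2 : Measurable g₂ := hG2.comp (measurable_snd.snd.fst.prodMk measurable_snd.snd.snd)
  have hfst : MeasurePreserving (Prod.fst : E × E × E → E) (μ.map V) (μ.map (X k)) :=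
    ⟨measurable_fst, by rw [Measure.map_map measurable_fst hVm]; rfl⟩
  have n1 : eLpNorm g₁ 3 ((μ.map (X i)).prod (μ.map V)) ≤ ENNReal.ofReal (4 * C) :=
    (eLpNorm_comp_measurePreserving hG1.aestronglyMeasurable
      ((MeasurePreserving.id _).prod hfst)).trans_le
      (eLpNorm_uncurry_degKernel_le hX hH hs hC0 hC hik)
  have n2 : eLpNorm g₂ 3 ((μ.map (X i)).prod (μ.map V)) ≤ ENNReal.ofReal (4 * C) := by
    have hm : Measurable fun v : E × E × E => degKernel μ X H j l v.2.1 v.2.2 :=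
      hG2.comp (measurable_snd.fst.prodMk measurable_snd.snd)
    have e := (eLpNorm_comp_measurePreserving (p := 3) hm.aestronglyMeasurable
      (measurePreserving_snd (μ := μ.map (X i)) (ν := μ.map V))).trans
      (eLpNorm_map_measure hm.aestronglyMeasurable hVm.aemeasurable)
    exact e.trans_le (eLpNorm_degKernel_comp_le hX hH hs hC0 hC hjl)
  have hQ := eLpNorm_mul_le_of_three hm1.aestronglyMeasurable hm2.aestronglyMeasurable n1 n2
    (by positivity)
  have key := norm_integral_sub_integral_prod_le (p := 3 / 2)
    (betaCoeff_le_of_sampleBeta_le hb (J₁ := {i}) (J₂ := {k, j, l}) (by simp)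
      (by exact_mod_cast Finset.card_le_three) (by simp [h1, h2, h3]))
    hb0 (sigmaGen_le hX _) (sigmaGen_le hX _) (measurable_sigmaGen (X := X) (J := {i}) (i := i)
      (by simp)) hVs (f := fun q => g₁ q * g₂ q) (hm1.mul hm2).stronglyMeasurable
    one_le_three_halves (sq_nonneg (4 * C)) (sq_nonneg (4 * C))
    (eLpNorm_mul_le_of_three (hm1.comp ((hX i).prodMk hVm)).aestronglyMeasurable
      (hm2.comp ((hX i).prodMk hVm)).aestronglyMeasurable
      (eLpNorm_degKernel_comp_le hX hH hs hC0 hC hik)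
      (eLpNorm_degKernel_comp_le hX hH hs hC0 hC hjl) (by positivity)) hQ
  have hint : Integrable (fun q => g₁ q * g₂ q) ((μ.map (X i)).prod (μ.map V)) :=
    MemLp.integrable one_le_three_halves
      ⟨(hm1.mul hm2).aestronglyMeasurable, hQ.trans_lt ENNReal.ofReal_lt_top⟩
  -- Under the product law the variable of node `i` is integrated out first; `g₂` is then a constant
  -- factor, and degeneracy of `g₁` gives zero.
  have hzero : ∫ q, g₁ q * g₂ q ∂((μ.map (X i)).prod (μ.map V)) = 0 := by
    rw [integral_prod_symm _ hint]
    refine integral_eq_zero_of_ae ?_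
    filter_upwards [hfst.quasiMeasurePreserving.ae (ae_integral_degKernel_eq_zero hX hH hs hC hik)]
      with v hv
    simp only [hg₁, hg₂, integral_mul_const, hv, zero_mul, Pi.zero_apply]
  rw [hzero, sub_zero, one_sub_inv_three_halves, Real.norm_eq_abs] at key
  exact key.trans (le_of_eq (by ring))

end Kernel

/-! ### The degenerate part and the quantitative normal approximation -/

section Sample

variable {ι Ω E : Type*} [Fintype ι] [MeasurableSpace Ω] [MeasurableSpace E] {μ : Measure Ω}
  {X : ι → Ω → E} {H : E → E → ℝ} {C : ℝ}

open scoped Classical in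
/-- The sum of the degenerate parts of the kernel over ordered pairs of distinct nodes. -/
noncomputable def degSum (μ : Measure Ω) (X : ι → Ω → E) (H : E → E → ℝ) (ω : Ω) : ℝ :=
  ∑ i, ∑ k, if i = k then 0 else degKernel μ X H i k (X i ω) (X k ω)

variable [IsProbabilityMeasure μ]

theorem measurable_degSum (hX : ∀ i, Measurable (X i)) (hH : Measurable (Function.uncurry H)) :
    Measurable (degSum μ X H) := by
  classical
  refine Finset.measurable_fun_sum _ fun i _ => Finset.measurable_fun_sum _ fun k _ => ?_
  split_ifs
  · exact measurable_const
  · exact (measurable_degKernel hX hH i k).comp ((hX i).prodMk (hX k))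

/-- The expanded square is a sum over quadruples, to which the count of quadruples without isolated
nodes applies. The diagonal terms are zero, so the kernel moment bounds are only needed at distinct
nodes. -/
theorem integral_degSum_sq_le [EMetricSpace ι] {m : ℝ≥0} {b : ℝ} {η : ℕ}
    (hX : ∀ i, Measurable (X i))
    (hH : Measurable (Function.uncurry H)) (hs : ∀ x y, H x y = H y x) (hC0 : 0 ≤ C)
    (hC : sampleKernelNorm μ X H 3 ≤ ENNReal.ofReal C) (hη : ∀ i : ι, (nbhd m i).card ≤ η)
    (hb0 : 0 ≤ b) (hb : sampleBeta μ X 1 3 m ≤ ENNReal.ofReal b) :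
    Integrable (fun ω => degSum μ X H ω ^ 2) μ ∧
    ∫ ω, degSum μ X H ω ^ 2 ∂μ
      ≤ (Fintype.card ι : ℝ) ^ 4 * (2 * (4 * C) ^ 2 * (2 * b) ^ (1 / 3 : ℝ))
        + 9 * (4 * C) ^ 2 * (Fintype.card ι * η) ^ 2 := by
  classical
  set Y : ι → ι → Ω → ℝ := fun i k ω =>
    if i = k then 0 else degKernel μ X H i k (X i ω) (X k ω) with hY
  have hYd : ∀ i, Y i i = fun _ => 0 := fun i => by simp [hY]
  have hYo : ∀ {i k}, i ≠ k → Y i k = fun ω => degKernel μ X H i k (X i ω) (X k ω) :=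
    fun {i k} h => by simp [hY, h]
  have hYc : ∀ i k, Y i k = Y k i := fun i k => by
    rcases eq_or_ne i k with rfl | h
    · rfl
    · rw [hYo h, hYo h.symm]
      ext ω
      exact degKernel_comm hX hH hs hC h _ _
  have hYm : ∀ i k, AEStronglyMeasurable (Y i k) μ := fun i k => by
    rcases eq_or_ne i k with rfl | h
    · rw [hYd]
      exact aestronglyMeasurable_const
    · rw [hYo h]
      exact ((measurable_degKernel hX hH i k).comp
        ((hX i).prodMk (hX k))).aestronglyMeasurable
  have hY3 : ∀ i k, eLpNorm (Y i k) 3 μ ≤ ENNReal.ofReal (4 * C) := fun i k => by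
    rcases eq_or_ne i k with rfl | h
    · simp [hYd]
    · rw [hYo h]
      exact eLpNorm_degKernel_comp_le hX hH hs hC0 hC h
  have hl1 : ∀ i k j l, eLpNorm (fun ω => Y i k ω * Y j l ω) 1 μ
      ≤ ENNReal.ofReal ((4 * C) ^ 2) := fun i k j l =>
    (eLpNorm_le_eLpNorm_of_exponent_le one_le_three_halves ((hYm i k).mul (hYm j l))).trans
      (eLpNorm_mul_le_of_three (hYm i k) (hYm j l) (hY3 i k) (hY3 j l) (by positivity))
  have hint : ∀ i k j l, Integrable (fun ω => Y i k ω * Y j l ω) μ := fun i k j l =>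
    integrable_of_eLpNorm_one_le ((hYm i k).mul (hYm j l)) (hl1 i k j l)
  set B : ι → ι → ι → ι → ℝ := fun i k j l => ∫ ω, Y i k ω * Y j l ω ∂μ with hB
  set δ : ℝ := 2 * (4 * C) ^ 2 * (2 * b) ^ (1 / 3 : ℝ) with hδ
  have hδ0 : 0 ≤ δ := by positivity
  have hiso : ∀ i k j l, k ∉ nbhd m i → j ∉ nbhd m i → l ∉ nbhd m i → B i k j l ≤ δ := by
    intro i k j l h1 h2 h3
    rcases eq_or_ne i k with rfl | hik
    · simpa [hB, hYd] using hδ0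
    rcases eq_or_ne j l with rfl | hjl
    · simpa [hB, hYd] using hδ0
    simp only [hB, hYo hik, hYo hjl]
    exact (le_abs_self _).trans
      (abs_integral_degKernel_mul_le hX hH hs hC0 hC hb0 hb hik hjl h1 h2 h3)
  have hsq : ∀ ω, degSum μ X H ω ^ 2 = ∑ i, ∑ k, ∑ j, ∑ l, Y i k ω * Y j l ω := by
    intro ω
    have : degSum μ X H ω = ∑ i, ∑ k, Y i k ω := rfl
    rw [this, sq, Finset.sum_mul_sum]
    refine Finset.sum_congr rfl fun i _ => ?_
    simp_rw [Finset.sum_mul_sum]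
    exact Finset.sum_comm
  have hq := sum_quadruple_le (c := fun i j => j ∈ nbhd m i) (η := η) (B := B)
    (M := (4 * C) ^ 2) (δ := δ) (fun i j => mem_nbhd_comm)
    (fun i => by simpa using hη i) (by positivity) hδ0
    (fun i k j l => (le_abs_self _).trans (abs_integral_le_integral_abs.trans
      (integral_abs_le_of_eLpNorm_one_le ((hYm i k).mul (hYm j l)) (hl1 i k j l) (by positivity))))
    -- An isolated `k` is brought to first position by the symmetry of `Y`, and an isolated `j` by
    -- exchanging the two factors.
    hiso (fun i k j l h1 h2 h3 => by
      have := hiso k i j l h1 h2 h3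
      simpa only [hB, hYc k i] using this)
    (fun i k j l h1 h2 h3 => by
      have := hiso j l i k h3 h1 h2
      simpa only [hB, mul_comm] using this)
  simp_rw [hsq]
  have I3 : ∀ i k j, Integrable (fun ω => ∑ l, Y i k ω * Y j l ω) μ := fun i k j =>
    integrable_finsetSum _ fun l _ => hint i k j l
  have I2 : ∀ i k, Integrable (fun ω => ∑ j, ∑ l, Y i k ω * Y j l ω) μ := fun i k =>
    integrable_finsetSum _ fun j _ => I3 i k j
  have I1 : ∀ i, Integrable (fun ω => ∑ k, ∑ j, ∑ l, Y i k ω * Y j l ω) μ := fun i =>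
    integrable_finsetSum _ fun k _ => I2 i k
  refine ⟨integrable_finsetSum _ fun i _ => I1 i, le_trans (le_of_eq ?_) hq⟩
  rw [integral_finsetSum _ fun i _ => I1 i]
  refine Finset.sum_congr rfl fun i _ => ?_
  rw [integral_finsetSum _ fun k _ => I2 i k]
  refine Finset.sum_congr rfl fun k _ => ?_
  rw [integral_finsetSum _ fun j _ => I3 i k j]
  refine Finset.sum_congr rfl fun j _ => ?_
  rw [integral_finsetSum _ fun l _ => hint i k j l]

/-- Hoeffding decomposition of the centred U-statistic. -/
theorem uStat_sub_eq (hX : ∀ i, Measurable (X i)) (hH : Measurable (Function.uncurry H))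
    (hs : ∀ x y, H x y = H y x) (hC : sampleKernelNorm μ X H 3 ≤ ENNReal.ofReal C)
    (hn : 2 ≤ Fintype.card ι) (ω : Ω) :
    (open scoped Classical in
      uStat X H ω - ∑ i, ∑ k ∈ Finset.univ.erase i, kernelMean μ X H i k)
      = 2 * ((Fintype.card ι : ℝ) - 1) * ∑ i, linProj μ X H i ω + degSum μ X H ω := by
  classical
  have her : ∀ (i : ι) (f : ι → ℝ), ∑ k ∈ Finset.univ.erase i, f k
      = ∑ k, if i = k then 0 else f k := fun i f => by
    rw [← Finset.add_sum_erase (a := i) _ _ (Finset.mem_univ i)]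
    rw [if_pos rfl, zero_add]
    exact Finset.sum_congr rfl fun k hk => by rw [if_neg (Finset.ne_of_mem_erase hk).symm]
  have hn' : (Fintype.card ι : ℝ) - 1 ≠ 0 := by
    have : (2 : ℝ) ≤ Fintype.card ι := by exact_mod_cast hn
    linarith
  set a : ι → ι → ℝ := fun i k => if i = k then 0 else
    kernelProj μ X H k (X i ω) - kernelMean μ X H i k with ha
  have hlin : ((Fintype.card ι : ℝ) - 1) * ∑ i, linProj μ X H i ω = ∑ i, ∑ k, a i k := by
    rw [Finset.mul_sum]
    refine Finset.sum_congr rfl fun i _ => ?_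
    rw [linProj, mul_inv_cancel_left₀ hn', her]
  have hswap : ∑ i, ∑ k, a k i = ∑ i, ∑ k, a i k := Finset.sum_comm
  -- Each ordered pair carries the projections on both of its nodes; relabelling one of them shows
  -- that they sum to the same thing, whence the factor `2`.
  have htwo : 2 * ((Fintype.card ι : ℝ) - 1) * ∑ i, linProj μ X H i ω
      = ∑ i, ∑ k, a i k + ∑ i, ∑ k, a k i := by
    rw [hswap, mul_assoc, hlin]
    ring
  rw [htwo, uStat, degSum]
  simp only [her, ← Finset.sum_sub_distrib, ← Finset.sum_add_distrib]
  refine Finset.sum_congr rfl fun i _ => Finset.sum_congr rfl fun k _ => ?_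
  rcases eq_or_ne i k with rfl | hik
  · simp [ha]
  · simp only [ha, if_neg hik, if_neg hik.symm, degKernel]
    rw [kernelMean_comm hX hH hs hC hik]
    ring

/-- The projection `h_i` is a function of `X i` alone, so it inherits the mixing of the sample; the
`σ`-algebra `F` is left free to be one generated by a group of nodes. -/
theorem measurable_linProj {Ω : Type*} {F mΩ : MeasurableSpace Ω} {μ : Measure Ω}
    [IsProbabilityMeasure μ] {X : ι → Ω → E} (hX : ∀ i, Measurable (X i))
    (hH : Measurable (Function.uncurry H)) {i : ι} (hi : Measurable[F] (X i)) :
    Measurable[F] (linProj μ X H i) := by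
  classical
  refine Measurable.const_mul (Finset.measurable_fun_sum _ fun k _ => Measurable.sub ?_ ?_) _
  · exact (measurable_kernelProj hX hH k).comp hi
  · exact measurable_const

omit [Fintype ι] in
theorem integrable_kernelProj_comp (hX : ∀ i, Measurable (X i))
    (hH : Measurable (Function.uncurry H)) (hs : ∀ x y, H x y = H y x)
    (hC : sampleKernelNorm μ X H 3 ≤ ENNReal.ofReal C) {i k : ι} (hik : i ≠ k) :
    Integrable (fun ω => kernelProj μ X H k (X i ω)) μ :=
  MemLp.integrable (q := 3) (by norm_num)
    ⟨((measurable_kernelProj hX hH k).comp (hX i)).aestronglyMeasurable,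
      (eLpNorm_kernelProj_comp_le hX hH hs hC hik).trans_lt ENNReal.ofReal_lt_top⟩

theorem integral_linProj (hX : ∀ i, Measurable (X i)) (hH : Measurable (Function.uncurry H))
    (hs : ∀ x y, H x y = H y x) (hC : sampleKernelNorm μ X H 3 ≤ ENNReal.ofReal C) (i : ι) :
    ∫ ω, linProj μ X H i ω ∂μ = 0 := by
  classical
  simp only [linProj]
  have hint : ∀ k ∈ Finset.univ.erase i,
      Integrable (fun ω => kernelProj μ X H k (X i ω)) μ := fun k hk =>
    integrable_kernelProj_comp hX hH hs hC (Finset.ne_of_mem_erase hk).symm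
  have hint' : ∀ k ∈ Finset.univ.erase i,
      Integrable (fun ω => kernelProj μ X H k (X i ω) - kernelMean μ X H i k) μ := fun k hk =>
    (hint k hk).sub (integrable_const _)
  rw [integral_const_mul, integral_finsetSum _ hint', Finset.sum_eq_zero, mul_zero]
  intro k hk
  rw [integral_sub (hint k hk) (integrable_const _)]
  simp [kernelMean]

/-- The average of `n - 1` centred terms, each a projection and its mean, both of norm at most `C`.
-/
theorem eLpNorm_linProj_le (hX : ∀ i, Measurable (X i)) (hH : Measurable (Function.uncurry H))
    (hs : ∀ x y, H x y = H y x) (hC0 : 0 ≤ C) (hC : sampleKernelNorm μ X H 3 ≤ ENNReal.ofReal C)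
    (hn : 2 ≤ Fintype.card ι) (i : ι) :
    eLpNorm (linProj μ X H i) 3 μ ≤ ENNReal.ofReal (2 * C) := by
  classical
  have hn' : 0 < (Fintype.card ι : ℝ) - 1 := by
    have : (2 : ℝ) ≤ Fintype.card ι := by exact_mod_cast hn
    linarith
  have hm : ∀ k, AEStronglyMeasurable (fun ω => kernelProj μ X H k (X i ω)) μ := fun k =>
    ((measurable_kernelProj hX hH k).comp (hX i)).aestronglyMeasurable
  have hterm : ∀ k ∈ Finset.univ.erase i,
      eLpNorm (fun ω => kernelProj μ X H k (X i ω) - kernelMean μ X H i k) 3 μ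
        ≤ ENNReal.ofReal (2 * C) := fun k hk => by
    have hik : i ≠ k := (Finset.ne_of_mem_erase hk).symm
    rw [two_mul, ENNReal.ofReal_add hC0 hC0]
    exact (eLpNorm_sub_le (hm k) aestronglyMeasurable_const (by norm_num)).trans
      (add_le_add (eLpNorm_kernelProj_comp_le hX hH hs hC hik)
        (eLpNorm_const_kernelMean_le hX hH hs hC0 hC hik μ))
  have hsum : eLpNorm (∑ k ∈ Finset.univ.erase i,
      fun ω => kernelProj μ X H k (X i ω) - kernelMean μ X H i k) 3 μ
      ≤ ENNReal.ofReal (((Fintype.card ι : ℝ) - 1) * (2 * C)) := by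
    refine (eLpNorm_sum_le (fun k _ => (hm k).sub aestronglyMeasurable_const)
      (by norm_num)).trans ?_
    refine (Finset.sum_le_sum hterm).trans (le_of_eq ?_)
    rw [Finset.sum_const, Finset.card_erase_of_mem (Finset.mem_univ i), Finset.card_univ,
      nsmul_eq_mul, ENNReal.ofReal_mul hn'.le, ← ENNReal.ofReal_natCast, Nat.cast_sub (by omega)]
    simp
  have e : linProj μ X H i = ((Fintype.card ι : ℝ) - 1)⁻¹ • ∑ k ∈ Finset.univ.erase i,
      fun ω => kernelProj μ X H k (X i ω) - kernelMean μ X H i k := by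
    ext ω
    simp only [linProj, Pi.smul_apply, Finset.sum_apply, smul_eq_mul]
  rw [e, eLpNorm_const_smul, ← ofReal_norm, Real.norm_eq_abs, abs_of_pos (inv_pos.2 hn')]
  refine (mul_le_mul_right hsum _).trans (le_of_eq ?_)
  rw [← ENNReal.ofReal_mul (inv_pos.2 hn').le]
  congr 1
  field_simp

end Sample

/-- Quantitative normal approximation for the characteristic function of the normalised
U-statistic of one sample. -/
theorem norm_integral_cexp_normUStat_sub_le {ι Ω E : Type*} [Fintype ι] [EMetricSpace ι]
    [MeasurableSpace Ω] [MeasurableSpace E] {μ : Measure Ω} [IsProbabilityMeasure μ]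
    {X : ι → Ω → E} {H : E → E → ℝ} {C K b₁ b₂ : ℝ} {m : ℝ≥0} {η : ℕ}
    (hX : ∀ i, Measurable (X i)) (hH : Measurable (Function.uncurry H))
    (hs : ∀ x y, H x y = H y x) (hC0 : 0 ≤ C) (hC : sampleKernelNorm μ X H 3 ≤ ENNReal.ofReal C)
    (hn : 2 ≤ Fintype.card ι) (hη : ∀ i : ι, (nbhd m i).card ≤ η) (hb10 : 0 ≤ b₁) (hb20 : 0 ≤ b₂)
    (hb1 : sampleBeta μ X 1 3 m ≤ ENNReal.ofReal b₁)
    (hb2 : sampleBeta μ X 2 ⊤ m ≤ ENNReal.ofReal b₂)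
    (hv : 0 < projVar μ X H) (hK : 2 * C / √(projVar μ X H) ≤ K) (t : ℝ) :
    ‖∫ ω, Complex.exp ((t * normUStat μ X H ω : ℝ) * Complex.I) ∂μ - Complex.exp (-(t ^ 2 / 2))‖
      ≤ |t| * √(((Fintype.card ι : ℝ) ^ 4 * (2 * (4 * C) ^ 2 * (2 * b₁) ^ (1 / 3 : ℝ))
          + 9 * (4 * C) ^ 2 * (Fintype.card ι * η) ^ 2)
          / (2 * ((Fintype.card ι : ℝ) - 1) * √(projVar μ X H)) ^ 2)
        + (Fintype.card ι * (2 * K * (2 * b₂) ^ (1 / 2 : ℝ))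
          + 5 * (Fintype.card ι * (η ^ 2 * K ^ 3))
          + Fintype.card ι * η * (2 * K ^ 2 * (2 * b₂) ^ (1 / 3 : ℝ))
          + Fintype.card ι ^ 2 * (2 * K ^ 2 * (2 * b₁) ^ (1 / 3 : ℝ))) * (1 + |t|) ^ 2 * |t| := by
  classical
  set ν := √(projVar μ X H) with hν
  have hν0 : 0 < ν := Real.sqrt_pos.2 hv
  have hK0 : 0 ≤ K := le_trans (by positivity) hK
  have hn' : 0 < (Fintype.card ι : ℝ) - 1 := by
    have : (2 : ℝ) ≤ Fintype.card ι := by exact_mod_cast hn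
    linarith
  set ξ : ι → Ω → ℝ := fun i ω => ν⁻¹ * linProj μ X H i ω with hξdef
  have hξ : ∀ i J, i ∈ J → Measurable[sigmaGen X J] (ξ i) := fun i J hi =>
    (measurable_linProj hX hH (measurable_sigmaGen hi)).const_mul _
  have hhm : ∀ i, Measurable (linProj μ X H i) := fun i => measurable_linProj hX hH (hX i)
  have hξm : ∀ i, Measurable (ξ i) := fun i => (hhm i).const_mul _
  have hh3 : ∀ i, MemLp (linProj μ X H i) 3 μ := fun i => ⟨(hhm i).aestronglyMeasurable,
    (eLpNorm_linProj_le hX hH hs hC0 hC hn i).trans_lt ENNReal.ofReal_lt_top⟩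
  have hh1 : ∀ i, Integrable (linProj μ X H i) μ := fun i => (hh3 i).integrable (by norm_num)
  have hξ3 : ∀ i, eLpNorm (ξ i) 3 μ ≤ ENNReal.ofReal K := fun i => by
    have e : ξ i = ν⁻¹ • linProj μ X H i := rfl
    rw [e, eLpNorm_const_smul, ← ofReal_norm, Real.norm_eq_abs, abs_of_pos (inv_pos.2 hν0)]
    refine (mul_le_mul_right (eLpNorm_linProj_le hX hH hs hC0 hC hn i) _).trans ?_
    rw [← ENNReal.ofReal_mul (inv_pos.2 hν0).le]
    refine ENNReal.ofReal_le_ofReal (le_trans (le_of_eq ?_) hK)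
    rw [div_eq_inv_mul]
  have hξ0 : ∀ i, ∫ ω, ξ i ω ∂μ = 0 := fun i => by
    rw [integral_const_mul, integral_linProj hX hH hs hC, mul_zero]
  have hvar : ∫ ω, (∑ i, ξ i ω) ^ 2 ∂μ = 1 := by
    have h1 : projVar μ X H = ∫ ω, (∑ i, linProj μ X H i ω) ^ 2 ∂μ := by
      rw [projVar, variance_of_integral_eq_zero
        (Finset.measurable_fun_sum _ fun i _ => hhm i).aemeasurable]
      · rw [integral_finsetSum _ fun i _ => hh1 i]
        exact Finset.sum_eq_zero fun i _ => integral_linProj hX hH hs hC i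
    simp_rw [hξdef, ← Finset.mul_sum, mul_pow]
    rw [integral_const_mul, ← h1, inv_pow, hν, Real.sq_sqrt hv.le, inv_mul_cancel₀ hv.ne']
  have hWm : Measurable fun ω => ∑ i, ξ i ω := Finset.measurable_fun_sum _ fun i _ => hξm i
  have hWi : Integrable (fun ω => ∑ i, ξ i ω) μ :=
    integrable_finsetSum _ fun i _ => (hh1 i).const_mul _
  set D : ℝ := 2 * ((Fintype.card ι : ℝ) - 1) * ν with hD
  have hD0 : 0 < D := by positivity
  have hdecomp : ∀ ω, normUStat μ X H ω = ∑ i, ξ i ω + degSum μ X H ω / D := fun ω => by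
    have := uStat_sub_eq hX hH hs hC hn ω
    rw [normUStat, this, hξdef, ← Finset.mul_sum, ← hν, ← hD, add_div]
    congr 1
    rw [hD]
    field_simp
  have hUm : Measurable (normUStat μ X H) := by
    rw [show normUStat μ X H = fun ω => ∑ i, ξ i ω + degSum μ X H ω / D from funext hdecomp]
    exact hWm.add ((measurable_degSum hX hH).div_const _)
  obtain ⟨hRi, hR⟩ := integral_degSum_sq_le hX hH hs hC0 hC hη hb10 hb1
  have hdiff : ∀ ω, (normUStat μ X H ω - ∑ i, ξ i ω) ^ 2 = degSum μ X H ω ^ 2 / D ^ 2 := fun ω => by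
    rw [hdecomp, add_sub_cancel_left, div_pow]
  have h1 := norm_integral_cexp_sub_integral_cexp_le hUm hWm
    (δ := ((Fintype.card ι : ℝ) ^ 4 * (2 * (4 * C) ^ 2 * (2 * b₁) ^ (1 / 3 : ℝ))
          + 9 * (4 * C) ^ 2 * (Fintype.card ι * η) ^ 2) / D ^ 2)
    (by simp_rw [hdiff]; exact hRi.div_const _)
    (by
      simp_rw [hdiff]
      rw [integral_div]
      gcongr) t
  have h2 := norm_integral_cexp_sub_le hWm hWi
    (ε := Fintype.card ι * (2 * K * (2 * b₂) ^ (1 / 2 : ℝ))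
          + 5 * (Fintype.card ι * (η ^ 2 * K ^ 3))
          + Fintype.card ι * η * (2 * K ^ 2 * (2 * b₂) ^ (1 / 3 : ℝ))
          + Fintype.card ι ^ 2 * (2 * K ^ 2 * (2 * b₁) ^ (1 / 3 : ℝ))) (by positivity)
    (fun s => by
      refine (norm_integral_sum_mul_cexp_sub_le hX hξ hK0 hξ3 hξ0 hη hb10 hb20 hb1 hb2
        hvar s).trans ?_
      obtain ⟨a, ha⟩ : ∃ a, a = Fintype.card ι * (2 * K * (2 * b₂) ^ (1 / 2 : ℝ)) := ⟨_, rfl⟩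
      obtain ⟨b, hb⟩ : ∃ b, b = Fintype.card ι * (η ^ 2 * K ^ 3 : ℝ) := ⟨_, rfl⟩
      obtain ⟨c, hc⟩ : ∃ c, c = Fintype.card ι * η * (2 * K ^ 2 * (2 * b₂) ^ (1 / 3 : ℝ)) := ⟨_, rfl⟩
      obtain ⟨d, hd⟩ : ∃ d, d = (Fintype.card ι : ℝ) ^ 2 * (2 * K ^ 2 * (2 * b₁) ^ (1 / 3 : ℝ)) := ⟨_, rfl⟩
      have ha0 : 0 ≤ a := by rw [ha]; positivity
      have hb0 : 0 ≤ b := by rw [hb]; positivity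
      have hc0 : 0 ≤ c := by rw [hc]; positivity
      have hd0 : 0 ≤ d := by rw [hd]; positivity
      have hs0 := abs_nonneg s
      -- The coefficient `5` collects one `η ^ 2 * K ^ 3` from the second-order remainder and four
      -- from decorrelating the products. All powers of `|s|` are then dominated by `(1 + |s|) ^ 2`.
      refine le_trans (le_of_eq (b := a + 5 * b * |s| ^ 2 + c * |s| + d * |s|) ?_) ?_
      · rw [← sq_abs s, ha, hb, hc, hd]
        ring
      have hs2 : |s| ^ 2 ≤ (1 + |s|) ^ 2 := by nlinarith
      have hs1 : |s| ≤ (1 + |s|) ^ 2 := by nlinarith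
      have hs3 : 1 ≤ (1 + |s|) ^ 2 := by nlinarith
      rw [← ha, ← hb, ← hc, ← hd]
      have p1 := mul_le_mul_of_nonneg_left hs3 ha0
      have p2 := mul_le_mul_of_nonneg_left hs2 (by positivity : 0 ≤ 5 * b)
      have p3 := mul_le_mul_of_nonneg_left hs1 hc0
      have p4 := mul_le_mul_of_nonneg_left hs1 hd0
      linarith) t
  exact (norm_sub_le_norm_sub_add_norm_sub _ _ _).trans (add_le_add h1 h2)

/-! ### Rates -/

theorem card_nbhd_le_maxNbhd {ι : Type*} [Fintype ι] [EMetricSpace ι] (m : ℝ≥0) (i : ι) :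
    (nbhd m i).card ≤ maxNbhd ι m :=
  Finset.le_sup (f := fun i : ι => (nbhd m i).card) (Finset.mem_univ i)

/-- With `K = A / √n` the errors become functions of `n b₁^(1/3)`, `(n b₂)^(1/2)` and `η⁴ / n`. The
second term is of order `η² / √n = √(η⁴ / n)`, which is where the fourth power of `η` comes from.
The third is of order `(η³ b₂)^(1/3)`, and `η³ b₂ ≤ (η⁴ / n) (n b₂)` as `η` is a natural number. -/
theorem stein_error_le {n A b₁ b₂ : ℝ} {η : ℕ} (hn : 0 < n) (hb1 : 0 ≤ b₁) (hb2 : 0 ≤ b₂) :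
    n * (2 * (A / √n) * (2 * b₂) ^ (1 / 2 : ℝ)) + 5 * (n * (η ^ 2 * (A / √n) ^ 3))
      + n * η * (2 * (A / √n) ^ 2 * (2 * b₂) ^ (1 / 3 : ℝ))
      + n ^ 2 * (2 * (A / √n) ^ 2 * (2 * b₁) ^ (1 / 3 : ℝ))
    ≤ 2 * A * (2 : ℝ) ^ (1 / 2 : ℝ) * (n * b₂) ^ (1 / 2 : ℝ)
      + 5 * A ^ 3 * √((η : ℝ) ^ 4 / n)
      + 2 * A ^ 2 * (2 * ((η : ℝ) ^ 4 / n * ((n * b₂) ^ (1 / 2 : ℝ)) ^ 2)) ^ (1 / 3 : ℝ)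
      + 2 * A ^ 2 * (2 : ℝ) ^ (1 / 3 : ℝ) * (n * b₁ ^ (1 / 3 : ℝ)) := by
  have hsn : 0 < √n := Real.sqrt_pos.2 hn
  have hss : √n * √n = n := Real.mul_self_sqrt hn.le
  have e2 : (A / √n) ^ 2 = A ^ 2 / n := by rw [div_pow, Real.sq_sqrt hn.le]
  have e3 : n * (A / √n) ^ 3 = A ^ 3 / √n := by
    rw [pow_succ, e2]
    field_simp
  have e1 : n * (A / √n) = A * √n := by
    field_simp
    linear_combination (-A) * hss
  have t1 : n * (2 * (A / √n) * (2 * b₂) ^ (1 / 2 : ℝ))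
      = 2 * A * (2 : ℝ) ^ (1 / 2 : ℝ) * (n * b₂) ^ (1 / 2 : ℝ) := by
    rw [Real.mul_rpow (by norm_num) hb2, Real.mul_rpow hn.le hb2, ← Real.sqrt_eq_rpow n]
    linear_combination (2 * (2 : ℝ) ^ (1 / 2 : ℝ) * b₂ ^ (1 / 2 : ℝ)) * e1
  have t2 : 5 * (n * (η ^ 2 * (A / √n) ^ 3)) = 5 * A ^ 3 * √((η : ℝ) ^ 4 / n) := by
    rw [Real.sqrt_div (by positivity), show (η : ℝ) ^ 4 = ((η : ℝ) ^ 2) ^ 2 by ring,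
      Real.sqrt_sq (by positivity)]
    linear_combination (5 * (η : ℝ) ^ 2) * e3
  have t3 : n * η * (2 * (A / √n) ^ 2 * (2 * b₂) ^ (1 / 3 : ℝ))
      ≤ 2 * A ^ 2 * (2 * ((η : ℝ) ^ 4 / n * ((n * b₂) ^ (1 / 2 : ℝ)) ^ 2)) ^ (1 / 3 : ℝ) := by
    have h1 : ((n * b₂) ^ (1 / 2 : ℝ)) ^ 2 = n * b₂ := by
      rw [← Real.sqrt_eq_rpow, Real.sq_sqrt (by positivity)]
    have h2 : (η : ℝ) * (2 * b₂) ^ (1 / 3 : ℝ) = (2 * ((η : ℝ) ^ 3 * b₂)) ^ (1 / 3 : ℝ) := by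
      rw [show 2 * ((η : ℝ) ^ 3 * b₂) = (η : ℝ) ^ 3 * (2 * b₂) by ring,
        Real.mul_rpow (x := (η : ℝ) ^ 3) (by positivity) (by positivity), ← Real.rpow_natCast,
        ← Real.rpow_mul (by positivity)]
      norm_num
    have h3 : (η : ℝ) ^ 3 ≤ (η : ℝ) ^ 4 := by
      rcases Nat.eq_zero_or_pos η with rfl | h
      · simp
      · exact pow_le_pow_right₀ (by exact_mod_cast h) (by norm_num)
    calc _ = 2 * A ^ 2 * ((η : ℝ) * (2 * b₂) ^ (1 / 3 : ℝ)) := by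
          rw [e2]
          field_simp
      _ ≤ _ := by
          rw [h2, h1, show (η : ℝ) ^ 4 / n * (n * b₂) = (η : ℝ) ^ 4 * b₂ by field_simp]
          gcongr
  have t4 : n ^ 2 * (2 * (A / √n) ^ 2 * (2 * b₁) ^ (1 / 3 : ℝ))
      = 2 * A ^ 2 * (2 : ℝ) ^ (1 / 3 : ℝ) * (n * b₁ ^ (1 / 3 : ℝ)) := by
    rw [Real.mul_rpow (by norm_num) hb1, e2]
    field_simp
  rw [t1, t2, t4]
  linarith

/-- The squared normalisation is at least `n³ / c`, because `2 (n - 1) ≥ n` for `n ≥ 2`. This leaves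
`n b₁^(1/3)` and `η² / n ≤ η⁴ / n`. -/
theorem degenerate_error_le {n c C b₁ v : ℝ} {η : ℕ} (hn : 2 ≤ n) (hb1 : 0 ≤ b₁) (hc : 0 < c)
    (hv : n ≤ c * v) :
    (n ^ 4 * (2 * (4 * C) ^ 2 * (2 * b₁) ^ (1 / 3 : ℝ)) + 9 * (4 * C) ^ 2 * (n * η) ^ 2)
        / (2 * (n - 1) * √v) ^ 2
      ≤ c * (2 * (4 * C) ^ 2 * (2 : ℝ) ^ (1 / 3 : ℝ) * (n * b₁ ^ (1 / 3 : ℝ))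
        + 9 * (4 * C) ^ 2 * ((η : ℝ) ^ 4 / n)) := by
  have hn0 : 0 < n := by linarith
  have hv0 : 0 < v := by
    by_contra h
    have := mul_nonpos_of_nonneg_of_nonpos hc.le (not_lt.1 h)
    linarith
  have hη : (η : ℝ) ^ 2 ≤ (η : ℝ) ^ 4 := by
    rcases Nat.eq_zero_or_pos η with rfl | h
    · simp
    · exact pow_le_pow_right₀ (by exact_mod_cast h) (by norm_num)
  have hD : n ^ 3 ≤ c * (2 * (n - 1) * √v) ^ 2 := by
    rw [mul_pow, Real.sq_sqrt hv0.le]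
    have h1 : n ^ 2 ≤ (2 * (n - 1)) ^ 2 := by gcongr; linarith
    calc n ^ 3 = n ^ 2 * n := by ring
      _ ≤ (2 * (n - 1)) ^ 2 * (c * v) := by gcongr
      _ = _ := by ring
  have hDpos : 0 < (2 * (n - 1) * √v) ^ 2 := by
    have := Real.sqrt_pos.2 hv0
    have : 0 < n - 1 := by linarith
    positivity
  rw [div_le_iff₀ hDpos]
  have e : (n ^ 4 * (2 * (4 * C) ^ 2 * (2 * b₁) ^ (1 / 3 : ℝ)) + 9 * (4 * C) ^ 2 * (n * η) ^ 2)
      = (2 * (4 * C) ^ 2 * (2 : ℝ) ^ (1 / 3 : ℝ) * (n * b₁ ^ (1 / 3 : ℝ))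
        + 9 * (4 * C) ^ 2 * ((η : ℝ) ^ 2 / n)) * n ^ 3 := by
    rw [Real.mul_rpow (by norm_num) hb1]
    field_simp
  rw [e]
  calc _ ≤ (2 * (4 * C) ^ 2 * (2 : ℝ) ^ (1 / 3 : ℝ) * (n * b₁ ^ (1 / 3 : ℝ))
        + 9 * (4 * C) ^ 2 * ((η : ℝ) ^ 4 / n)) * (c * (2 * (n - 1) * √v) ^ 2) := by gcongr
    _ = _ := by ring

/-! ### The central limit theorem -/

theorem measurable_normUStat {ι Ω E : Type*} [Fintype ι] [MeasurableSpace Ω] [MeasurableSpace E]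
    {μ : Measure Ω} {X : ι → Ω → E} {H : E → E → ℝ}
    (hX : ∀ i, Measurable (X i)) (hH : Measurable (Function.uncurry H)) :
    Measurable (normUStat μ X H) := by
  classical
  refine Measurable.div_const (Measurable.sub_const ?_ _) _
  exact Finset.measurable_fun_sum _ fun i _ => Finset.measurable_fun_sum _ fun k _ =>
    hH.comp ((hX i).prodMk (hX k))

theorem mainTheorem6 {d : ℕ} {I Ω : ℕ → Type*}
    [∀ n, Fintype (I n)] [∀ n, EMetricSpace (I n)] [∀ n, MeasurableSpace (Ω n)]
    (μ : ∀ n, Measure (Ω n)) [∀ n, IsProbabilityMeasure (μ n)]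
    (X : ∀ n, I n → Ω n → EuclideanSpace ℝ (Fin d))
    (H : ℕ → EuclideanSpace ℝ (Fin d) → EuclideanSpace ℝ (Fin d) → ℝ)
    (m : ℕ → ℝ≥0)
    -- the sample of size `n` consists of random vectors indexed by a space of `n` nodes
    (hcard : ∀ n, Fintype.card (I n) = n)
    (hX : ∀ n i, Measurable (X n i))
    -- distinct nodes are at distance at least one
    (hsep : ∀ n (i j : I n), i ≠ j → 1 ≤ edist i j)
    -- the kernels are measurable, symmetric and square integrable
    (hHmeas : ∀ n, Measurable (Function.uncurry (H n)))
    (hHsymm : ∀ n x y, H n x y = H n y x)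
    (hHsq : ∀ n (i j : I n), i ≠ j →
      MemLp (Function.uncurry (H n)) 2 (((μ n).map (X n i)).prod ((μ n).map (X n j))))
    -- linear growth of the variance, and bounded third moments
    (hvar : (fun n => projVar (μ n) (X n) (H n)) =Θ[atTop] fun n => (n : ℝ))
    (hH3 : arrayKernelNorm μ X H 3 < ∞)
    -- sparsity and mixing along the sequence `m`
    (hm : ∀ n, 1 ≤ m n)
    (hη : (fun n => (maxNbhd (I n) (m n) : ℝ) ^ 4) =o[atTop] fun n => (n : ℝ))
    (hβ : Tendsto (fun n : ℕ => (n : ℝ≥0∞) * arrayBeta μ X 1 3 (m n) ^ (1 / 3 : ℝ)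
      + ((n : ℝ≥0∞) * arrayBeta μ X 2 ⊤ (m n)) ^ (1 / 2 : ℝ)) atTop (𝓝 0)) :
    TendstoInDistribution (fun n => normUStat (μ n) (X n) (H n)) atTop
      (fun z : ℝ => z) μ (gaussianReal 0 1) := by
  set C : ℝ := (arrayKernelNorm μ X H 3).toReal with hCdef
  have hC0 : 0 ≤ C := ENNReal.toReal_nonneg
  have hC : ∀ n, sampleKernelNorm (μ n) (X n) (H n) 3 ≤ ENNReal.ofReal C := fun n => by
    rw [hCdef, ENNReal.ofReal_toReal hH3.ne]
    exact le_iSup (fun n => sampleKernelNorm (μ n) (X n) (H n) 3) n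
  -- The lower half of the growth condition: eventually `n ≤ c ν²`.
  obtain ⟨c, hc0, hc⟩ := hvar.2.exists_pos
  set b₁ : ℕ → ℝ := fun n => (arrayBeta μ X 1 3 (m n)).toReal with hb₁
  set b₂ : ℕ → ℝ := fun n => (arrayBeta μ X 2 ⊤ (m n)).toReal with hb₂
  have hβ1 : Tendsto (fun n : ℕ => (n : ℝ≥0∞) * arrayBeta μ X 1 3 (m n) ^ (1 / 3 : ℝ)) atTop
      (𝓝 0) := tendsto_of_tendsto_of_tendsto_of_le_of_le tendsto_const_nhds hβ
    (fun _ => zero_le) fun _ => le_self_add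
  have hβ2 : Tendsto (fun n : ℕ => ((n : ℝ≥0∞) * arrayBeta μ X 2 ⊤ (m n)) ^ (1 / 2 : ℝ)) atTop
      (𝓝 0) := tendsto_of_tendsto_of_tendsto_of_le_of_le tendsto_const_nhds hβ
    (fun _ => zero_le) fun _ => le_add_self
  have L1 : Tendsto (fun n : ℕ => (n : ℝ) * b₁ n ^ (1 / 3 : ℝ)) atTop (𝓝 0) := by
    have := (ENNReal.tendsto_toReal ENNReal.zero_ne_top).comp hβ1
    simpa [Function.comp_def, ENNReal.toReal_mul, ← ENNReal.toReal_rpow] using this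
  have L2 : Tendsto (fun n : ℕ => ((n : ℝ) * b₂ n) ^ (1 / 2 : ℝ)) atTop (𝓝 0) := by
    have := (ENNReal.tendsto_toReal ENNReal.zero_ne_top).comp hβ2
    simpa [Function.comp_def, ENNReal.toReal_mul, ← ENNReal.toReal_rpow] using this
  have L3 : Tendsto (fun n : ℕ => (maxNbhd (I n) (m n) : ℝ) ^ 4 / n) atTop (𝓝 0) :=
    hη.tendsto_div_nhds_zero
  refine ⟨fun n => (measurable_normUStat (hX n) (hHmeas n)).aemeasurable, by fun_prop, ?_⟩
  -- Lévy's continuity theorem reduces the claim to pointwise convergence of characteristic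
  -- functions.
  refine ProbabilityMeasure.tendsto_iff_tendsto_charFun.2 fun t => ?_
  have hlim : charFun ((gaussianReal 0 1).map fun z : ℝ => z) t = Complex.exp (-(t ^ 2 / 2)) := by
    rw [Measure.map_id', charFun_gaussianReal]
    simp
  have hchar : ∀ n, charFun ((μ n).map (normUStat (μ n) (X n) (H n))) t
      = ∫ ω, Complex.exp ((t * normUStat (μ n) (X n) (H n) ω : ℝ) * Complex.I) ∂(μ n) := fun n => by
    rw [charFun_apply_real, integral_map (measurable_normUStat (hX n) (hHmeas n)).aemeasurable
      (by fun_prop)]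
    push_cast
    rfl
  simp only [ProbabilityMeasure.coe_mk, hlim, hchar]
  rw [tendsto_iff_norm_sub_tendsto_zero]
  set A : ℝ := 2 * C * √c with hA
  -- The total error bound as a function of `n b₁^(1/3)`, `(n b₂)^(1/2)` and `η⁴ / n`, in this
  -- order. It is continuous and vanishes at the origin, and all three arguments tend to zero.
  set G : ℝ × ℝ × ℝ → ℝ := fun q =>
    |t| * √(c * (2 * (4 * C) ^ 2 * (2 : ℝ) ^ (1 / 3 : ℝ) * q.1 + 9 * (4 * C) ^ 2 * q.2.2))
      + (2 * A * (2 : ℝ) ^ (1 / 2 : ℝ) * q.2.1 + 5 * A ^ 3 * √q.2.2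
        + 2 * A ^ 2 * (2 * (q.2.2 * q.2.1 ^ 2)) ^ (1 / 3 : ℝ)
        + 2 * A ^ 2 * (2 : ℝ) ^ (1 / 3 : ℝ) * q.1) * (1 + |t|) ^ 2 * |t| with hG
  have hGc : Continuous G := by
    have h3 : Continuous fun q : ℝ × ℝ × ℝ => (2 * (q.2.2 * q.2.1 ^ 2)) ^ (1 / 3 : ℝ) :=
      (Real.continuous_rpow_const (by norm_num)).comp (by fun_prop)
    fun_prop
  have hG0 : G (0, 0, 0) = 0 := by simp [hG]
  have hlimG := (hGc.tendsto (0, 0, 0)).comp (L1.prodMk_nhds (L2.prodMk_nhds L3))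
  rw [hG0] at hlimG
  refine tendsto_of_tendsto_of_tendsto_of_le_of_le' tendsto_const_nhds hlimG
    (Eventually.of_forall fun _ => norm_nonneg _) ?_
  filter_upwards [eventually_ge_atTop 2, hc.bound, hβ1.eventually_lt_const ENNReal.zero_lt_top,
    hβ2.eventually_lt_const ENNReal.zero_lt_top] with n hn hcn hβ1n hβ2n
  have hn0 : (n : ℝ≥0∞) ≠ 0 := by
    have : n ≠ 0 := by omega
    exact_mod_cast this
  -- Finiteness must be checked because `toReal` sends `∞` to `0`; an infinite coefficient would
  -- make the product with `n ≠ 0` infinite, against its being eventually finite.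
  have hf1 : arrayBeta μ X 1 3 (m n) ≠ ∞ := fun h => by
    rw [h, ENNReal.top_rpow_of_pos (by norm_num), ENNReal.mul_top hn0] at hβ1n
    exact lt_irrefl _ hβ1n
  have hf2 : arrayBeta μ X 2 ⊤ (m n) ≠ ∞ := fun h => by
    rw [h, ENNReal.mul_top hn0, ENNReal.top_rpow_of_pos (by norm_num)] at hβ2n
    exact lt_irrefl _ hβ2n
  have hs1 : sampleBeta (μ n) (X n) 1 3 (m n) ≤ ENNReal.ofReal (b₁ n) := by
    rw [hb₁, ENNReal.ofReal_toReal hf1]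
    exact le_iSup (fun k => sampleBeta (μ k) (X k) 1 3 (m n)) n
  have hs2 : sampleBeta (μ n) (X n) 2 ⊤ (m n) ≤ ENNReal.ofReal (b₂ n) := by
    rw [hb₂, ENNReal.ofReal_toReal hf2]
    exact le_iSup (fun k => sampleBeta (μ k) (X k) 2 ⊤ (m n)) n
  set v := projVar (μ n) (X n) (H n) with hv
  have hvnn : 0 ≤ v := variance_nonneg _ _
  have hn2 : (2 : ℝ) ≤ n := by exact_mod_cast hn
  have hvn : (n : ℝ) ≤ c * v := by
    simpa [Real.norm_eq_abs, abs_of_nonneg hvnn] using hcn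
  have hvpos : 0 < v := by
    rcases hvnn.eq_or_lt with h | h
    · rw [← h, mul_zero] at hvn
      linarith
    · exact h
  -- From `n ≤ c * v` one gets `1 / √v ≤ √c / √n`, which explains `A = 2 * C * √c`.
  have hK : 2 * C / √v ≤ A / √n := by
    have hsv := Real.sqrt_pos.2 hvpos
    have hsn : 0 < √(n : ℝ) := Real.sqrt_pos.2 (by linarith)
    rw [div_le_div_iff₀ hsv hsn, hA, mul_assoc (2 * C), ← Real.sqrt_mul hc0.le]
    gcongr
  have key := norm_integral_cexp_normUStat_sub_le (hX n) (hHmeas n) (hHsymm n) hC0 (hC n)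
    (by rw [hcard]; exact hn) (card_nbhd_le_maxNbhd (m n)) ENNReal.toReal_nonneg
    ENNReal.toReal_nonneg hs1 hs2 hvpos hK t
  rw [hcard] at key
  refine key.trans ?_
  refine add_le_add (mul_le_mul_of_nonneg_left (Real.sqrt_le_sqrt
    (degenerate_error_le hn2 ENNReal.toReal_nonneg hc0 hvn)) (abs_nonneg t)) ?_
  have hstein := stein_error_le (n := n) (A := A) (η := maxNbhd (I n) (m n)) (b₁ := b₁ n)
    (b₂ := b₂ n) (by linarith) ENNReal.toReal_nonneg ENNReal.toReal_nonneg
  exact mul_le_mul_of_nonneg_right (mul_le_mul_of_nonneg_right hstein (by positivity))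
    (abs_nonneg t)
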